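/- A concave distortion is a concave increasing function $\Psi:[0,1]\to[0,1]$ with $\Psi(0)=0$ and $\Psi(1)=1$ ("increasing" is understood in the non-strict sense throughout). Let $(\Psi_t)_{t\ge0}$ be a family of concave distortions with the semigroup property $\Psi_s\circ\Psi_t=\Psi_{s+t}$, $s,t\ge0$. Exclude the two trivial cases: $\Psi_t(x)=x$ for all $t\ge0$, $x\in[0,1]$; and $\Psi_t(x)=1$ for all $t>0$, $x\in(0,1]$. Let $$G(x)=\lim_{t\downarrow0}\frac{\Psi_t(x)-x}{t},\quad x\in(0,1),$$ be the generator of the semigroup. Let $(\Omega,\mathcal F,\mathsf P)$ be an atomless probability space. For a random variable $X$ with distribution function $D_X$, let $$\int_{\mathbb R}x\,d(\Psi_t(D_X(x)))=\int_{\mathbb R}x^+\,d(\Psi_t(D_X(x)))-\int_{\mathbb R}x^-\,d(\Psi_t(D_X(x)))\in[-\infty,\infty],$$ where $\infty-\infty=-\infty$ and where a positive limit of $\Psi_t(D_X)$ at $-\infty$ counts as a mass at $-\infty$, so that in that case $\int_{\mathbb R}x^-\,d(\Psi_t(D_X(x)))=\infty$. Let $$\alpha(X)=\sup\Bigl\{t\ge0:\int_{\mathbb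 R}x\,d(\Psi_t(D_X(x)))\ge0\Bigr\}\in[0,\infty],\qquad\sup\emptyset=0,$$ and let $L^1(\alpha)$ be the set of all random variables $X$ such that $\int_{\mathbb R}x\,d(\Psi_t(D_X(x)))>-\infty$ and $\int_{\mathbb R}x\,d(\Psi_t(D_{-X}(x)))>-\infty$ for all $t\ge0$. Random variables $X,Y$ are called comonotone if there are a random variable $Z$ and increasing functions $f,g$ such that $X=f(Z)$ and $Y=g(Z)$ almost surely. Then the following conditions are equivalent: (a) for any $X,Y\in L^1(\alpha)$ that are not comonotone and are such that $0<\alpha(X)=\alpha(Y)<\infty$, we have $\alpha(X+Y)>\alpha(X)$; (b) for any $t>0$, $\Psi_t$ is strictly concave on $[0,1]$; (c) $G$ is strictly concave on $(0,1)$, and $\int_{1-\varepsilon}^1\frac1{G(s)}\,ds=\infty$ for every $\varepsilon\in(0,1)$. -/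

import Mathlib

open MeasureTheory ProbabilityTheory Set Filter Topology
open scoped NNReal ENNReal

/-- A probability space is atomless if every measurable event of positive probability contains
a measurable event of strictly smaller positive probability. -/
def IsAtomless {Ω : Type*} [MeasurableSpace Ω] (P : Measure Ω) : Prop :=
  ∀ A : Set Ω, MeasurableSet A → 0 < P A →
    ∃ B : Set Ω, B ⊆ A ∧ MeasurableSet B ∧ 0 < P B ∧ P B < P A

/-- A concave distortion: a concave increasing function `[0,1] → [0,1]` that fixes `0` and `1`.
It is stored as a function on `ℝ`; its values outside `[0,1]` are never used. -/
structure ConcaveDistortion where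
  /-- the underlying function -/
  toFun : ℝ → ℝ
  mapsTo : MapsTo toFun (Icc 0 1) (Icc 0 1)
  concaveOn : ConcaveOn ℝ (Icc 0 1) toFun
  monotoneOn : MonotoneOn toFun (Icc 0 1)
  map_zero : toFun 0 = 0
  map_one : toFun 1 = 1

instance : CoeFun ConcaveDistortion (fun _ => ℝ → ℝ) := ⟨ConcaveDistortion.toFun⟩

/-- The semigroup property `Ψ_s ∘ Ψ_t = Ψ_{s+t}` on `[0,1]`, for all `s, t ≥ 0`. -/
def IsDistortionSemigroup (Ψ : ℝ≥0 → ConcaveDistortion) : Prop :=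
  ∀ s t : ℝ≥0, ∀ x ∈ Icc (0 : ℝ) 1, Ψ s (Ψ t x) = Ψ (s + t) x

/-- The family is neither the identity, `Ψ_t(x) = x` for all `t ≥ 0` and `x ∈ [0,1]`, nor
`Ψ_t(x) = 1` for all `t > 0` and `x ∈ (0,1]` (whatever `Ψ_0` is). -/
def IsNontrivialFamily (Ψ : ℝ≥0 → ConcaveDistortion) : Prop :=
  (¬ ∀ t : ℝ≥0, ∀ x ∈ Icc (0 : ℝ) 1, Ψ t x = x) ∧
  (¬ ∀ t : ℝ≥0, 0 < t → ∀ x ∈ Ioc (0 : ℝ) 1, Ψ t x = 1)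

/-- The generator `G(x) = lim_{t ↓ 0} (Ψ_t(x) - x) / t`. For a nontrivial distortion semigroup
the limit exists at every `x ∈ [0,1]`. -/
noncomputable def generator (Ψ : ℝ≥0 → ConcaveDistortion) (x : ℝ) : ℝ :=
  limUnder (𝓝[>] (0 : ℝ≥0)) (fun t => (Ψ t x - x) / (t : ℝ))

section Index

variable {Ω : Type*} [MeasurableSpace Ω]

/-- The distorted distribution function `x ↦ Ψ(D_X(x))`, with `D_X(x) = P(X ≤ x)`. -/
noncomputable def distortedCdf (P : Measure Ω) (Ψ : ConcaveDistortion) (X : Ω → ℝ) (x : ℝ) : ℝ :=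
  Ψ (cdf (P.map X) x)

theorem monotone_distortedCdf (P : Measure Ω) (Ψ : ConcaveDistortion) (X : Ω → ℝ) :
    Monotone (distortedCdf P Ψ X) := fun _ _ hxy =>
  Ψ.monotoneOn ⟨cdf_nonneg _ _, cdf_le_one _ _⟩ ⟨cdf_nonneg _ _, cdf_le_one _ _⟩
    (monotone_cdf _ hxy)

/-- The Lebesgue-Stieltjes measure `d(Ψ(D_X(x)))` on `ℝ`: the mass of `(a, b)` is
`Ψ(D_X(b-)) - Ψ(D_X(a+))`. -/
noncomputable def distortedLaw (P : Measure Ω) (Ψ : ConcaveDistortion) (X : Ω → ℝ) : Measure ℝ :=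
  (monotone_distortedCdf P Ψ X).stieltjesFunction.measure

/-- `∫ x⁺ d(Ψ(D_X(x)))`. -/
noncomputable def distortedPosPart (P : Measure Ω) (Ψ : ConcaveDistortion) (X : Ω → ℝ) : ℝ≥0∞ :=
  ∫⁻ x, ENNReal.ofReal x ∂(distortedLaw P Ψ X)

/-- `∫ x⁻ d(Ψ(D_X(x)))`. If `X` is unbounded below and `Ψ(0+) > 0`, then the function `Ψ(D_X)`
has the limit `Ψ(0+) > 0` at `-∞`, that is, a mass `Ψ(0+)` sits at `-∞` and the integral is
infinite; the second summand accounts for this mass (in `ℝ≥0∞`, `⊤ * 0 = 0`). -/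
noncomputable def distortedNegPart (P : Measure Ω) (Ψ : ConcaveDistortion) (X : Ω → ℝ) : ℝ≥0∞ :=
  ∫⁻ x, ENNReal.ofReal (-x) ∂(distortedLaw P Ψ X) +
    ⊤ * ENNReal.ofReal (⨅ x : ℝ, distortedCdf P Ψ X x)

/-- `∫ x d(Ψ(D_X(x)))`, with the convention `∞ - ∞ = -∞`, which is that of `EReal`. -/
noncomputable def distortedExpectation (P : Measure Ω) (Ψ : ConcaveDistortion) (X : Ω → ℝ) :
    EReal :=
  (distortedPosPart P Ψ X : EReal) - (distortedNegPart P Ψ X : EReal)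

/-- The acceptability index `α(X) = sup {t ≥ 0 : ∫ x d(Ψ_t(D_X(x))) ≥ 0} ∈ [0,∞]`, with
`sup ∅ = 0`. -/
noncomputable def acceptabilityIndex (P : Measure Ω) (Ψ : ℝ≥0 → ConcaveDistortion) (X : Ω → ℝ) :
    ℝ≥0∞ :=
  ⨆ (t : ℝ≥0) (_ : 0 ≤ distortedExpectation P (Ψ t) X), (t : ℝ≥0∞)

/-- The space `L¹(α)`: the random variables `X` such that `∫ x d(Ψ_t(D_X(x))) > -∞` and
`∫ x d(Ψ_t(D_{-X}(x))) > -∞` for all `t ≥ 0`. -/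
def indexL1 (P : Measure Ω) (Ψ : ℝ≥0 → ConcaveDistortion) : Set (Ω → ℝ) :=
  {X | Measurable X ∧ ∀ t : ℝ≥0, ⊥ < distortedExpectation P (Ψ t) X ∧
    ⊥ < distortedExpectation P (Ψ t) (-X)}

/-- Random variables `X, Y` are comonotone if `X = f(Z)` and `Y = g(Z)` almost surely, for a
random variable `Z` and increasing (not necessarily strictly) functions `f, g`. -/
def Comonotone (P : Measure Ω) (X Y : Ω → ℝ) : Prop :=
  ∃ (Z : Ω → ℝ) (f g : ℝ → ℝ), Measurable Z ∧ Monotone f ∧ Monotone g ∧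
    X =ᵐ[P] f ∘ Z ∧ Y =ᵐ[P] g ∘ Z

end Index

/-!
The middle condition is linked to the other two separately.

*Distortions and generator.* In a nontrivial semigroup the infimum of `Ψ_t` over `t > 0` is the
identity (`exists_lt_add`), so that every orbit `t ↦ Ψ_t(x)` is continuous and climbs through all of
`[x, 1)`. The generator `G` exists on `(0,1)` because a monotone orbit is differentiable somewhere
(`tendsto_generator`); it is concave and positive, and orbits solve `y' = G(y)` for right
derivatives. Hence `∫ 1/G` is travel time, and the integral condition says that orbits do not
reach `1` (`lintegral_inv_generator_eq_top_iff`). If `G` is affine on an interval, the equation is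
linear there and `Ψ_t` is affine on a smaller interval for small `t`. Conversely, if orbits do not
reach `1` and `Ψ_t` is affine on an interval, so is every `Ψ_s` with `s ≤ t`, and in the limit `G`
is.

*Strict concavity gives strict diversification.* By the layer cake formula the distorted
expectation is `U(X) = ∫ (1_{x ≥ 0} - Ψ(D_X(x))) dx`, with the mass at `-∞` included. It is
superadditive: for `Ψ(p) = min p l` it is the supremum over `c` of `l c - E (c - X)⁺`, and a general
`Ψ` is the limit of its piecewise linear interpolations, which are combinations of such functions
(`integral_distortionKernel_superadditive`). Strictness comes from one more observation. Random
variables that are not comonotone are oppositely ordered around some levels `a`, `b`. With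
`M = max(X - a, Y - b)` and `m = min(X - a, Y - b)` one has `X + Y - a - b = M + m`, while
`U(M) + U(m) > U(X - a) + U(Y - b)`, since `Ψ(P(A)) + Ψ(P(B)) > Ψ(P(A ∩ B)) + Ψ(P(A ∪ B))` for
events of which neither contains the other up to null sets. Continuity of `U` in `t` turns
`U(X + Y) > 0` into a strictly larger index.

*Failure of strict concavity.* If `Ψ_t` is affine on `[a, b]`, take events of probability `a`,
`(b - a)/2`, `(b - a)/2`, disjoint, and two random variables that differ only in which of the two
small events they penalize. They are not comonotone, but `U` is additive on them at time `t`. An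
additional penalty on an event of probability `c` with `Ψ_t(c) < 1` makes all three expectations
strictly decreasing at `t`, so that the index of the sum does not exceed `t`
(`exists_not_comonotone_acceptabilityIndex_add_le`).
-/

/-! ### Concave functions on an interval -/

theorem ConcaveOn.three_point {s : Set ℝ} {f : ℝ → ℝ} (hf : ConcaveOn ℝ s f) {x y z : ℝ}
    (hx : x ∈ s) (hz : z ∈ s) (hxy : x ≤ y) (hyz : y ≤ z) :
    (z - y) * f x + (y - x) * f z ≤ (z - x) * f y := by
  rcases eq_or_lt_of_le (hxy.trans hyz) with h | h
  · have h1 : y = x := by linarith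
    subst h1; subst h; simp
  · have hp : 0 < z - x := sub_pos.2 h
    have := hf.2 hx hz (show 0 ≤ (z - y) / (z - x) from div_nonneg (by linarith) hp.le)
      (show 0 ≤ (y - x) / (z - x) from div_nonneg (by linarith) hp.le) (by field_simp; ring)
    simp only [smul_eq_mul] at this
    have e : (z - y) / (z - x) * x + (y - x) / (z - x) * z = y := by field_simp; ring
    rw [e] at this
    have e2 : (z - x) * ((z - y) / (z - x) * f x + (y - x) / (z - x) * f z)
        = (z - y) * f x + (y - x) * f z := by field_simp
    rw [← e2]
    exact mul_le_mul_of_nonneg_left this hp.le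

/-- A nonnegative concave function that vanishes at an interior point vanishes identically. -/
theorem ConcaveOn.eq_zero_of_interior_zero {a b w : ℝ} {g : ℝ → ℝ}
    (hg : ConcaveOn ℝ (Icc a b) g) (h0 : ∀ x ∈ Icc a b, 0 ≤ g x) (hw : w ∈ Ioo a b)
    (hgw : g w = 0) {x : ℝ} (hx : x ∈ Icc a b) : g x = 0 := by
  have hab : a ≤ b := hx.1.trans hx.2
  refine le_antisymm ?_ (h0 x hx)
  rcases le_total x w with h | h
  · have := hg.three_point hx (right_mem_Icc.2 hab) h hw.2.le
    rw [hgw, mul_zero] at this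
    have h1 := mul_nonneg (sub_nonneg.2 h) (h0 b (right_mem_Icc.2 hab))
    have h2 : 0 < b - w := sub_pos.2 hw.2
    exact nonpos_of_mul_nonpos_right (by linarith) h2
  · have := hg.three_point (left_mem_Icc.2 hab) hx hw.1.le h
    rw [hgw, mul_zero] at this
    have h1 := mul_nonneg (sub_nonneg.2 h) (h0 a (left_mem_Icc.2 hab))
    have h2 : 0 < w - a := sub_pos.2 hw.1
    exact nonpos_of_mul_nonpos_right (by linarith) h2

/-- A concave function that is not strictly concave is affine on a nondegenerate interval. -/
theorem ConcaveOn.exists_affine_of_not_strict {s : Set ℝ} {f : ℝ → ℝ} (hf : ConcaveOn ℝ s f)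
    (hns : ¬ StrictConcaveOn ℝ s f) :
    ∃ a b p q : ℝ, a ∈ s ∧ b ∈ s ∧ a < b ∧ ∀ x ∈ Icc a b, f x = p * x + q := by
  have : ∃ x ∈ s, ∃ y ∈ s, x < y ∧ ∃ w ∈ Ioo x y,
      (y - x) * f w ≤ (y - w) * f x + (w - x) * f y := by
    by_contra! hcon
    refine hns (LinearOrder.strictConcaveOn_of_lt hf.1 ?_)
    intro x hx y hy hxy a b ha hb hab
    have hw : a • x + b • y ∈ Ioo x y := by
      simp only [smul_eq_mul]
      have : b = 1 - a := by linarith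
      subst this
      constructor <;> nlinarith
    have h := hcon x hx y hy hxy _ hw
    simp only [smul_eq_mul] at h ⊢
    have e1 : y - (a * x + b * y) = a * (y - x) := by
      have : b = 1 - a := by linarith
      subst this; ring
    have e2 : a * x + b * y - x = b * (y - x) := by
      have : b = 1 - a := by linarith
      subst this; ring
    rw [e1, e2] at h
    have hp : 0 < y - x := sub_pos.2 hxy
    refine lt_of_mul_lt_mul_left ?_ hp.le
    linarith
  obtain ⟨x, hx, y, hy, hxy, w, hw, hle⟩ := this
  have hp : 0 < y - x := sub_pos.2 hxy
  set p := (f y - f x) / (y - x) with hpdef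
  have hpm : p * (y - x) = f y - f x := by rw [hpdef]; field_simp
  have hsub : Icc x y ⊆ s := fun z hz => hf.1.ordConnected.out hx hy hz
  refine ⟨x, y, p, f x - p * x, hx, hy, hxy, fun z hz => ?_⟩
  -- the excess over the chord is concave, nonnegative and vanishes at `w`
  have hg : ConcaveOn ℝ (Icc x y) (fun z => f z - (p * z + (f x - p * x))) := by
    refine (hf.subset hsub (convex_Icc x y)).sub ?_
    refine ⟨convex_Icc x y, ?_⟩
    intro u _ v _ a b _ _ hab
    simp only [smul_eq_mul]
    have : b = 1 - a := by linarith
    subst this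
    apply le_of_eq; ring
  have hnn : ∀ z ∈ Icc x y, 0 ≤ f z - (p * z + (f x - p * x)) := by
    intro z hz
    have h3 := hf.three_point hx hy hz.1 hz.2
    have : (y - x) * (f z - (p * z + (f x - p * x))) =
        (y - x) * f z - ((y - z) * f x + (z - x) * f y) := by
      linear_combination (-(z - x)) * hpm
    exact nonneg_of_mul_nonneg_right (by rw [this]; linarith) hp
  have hw0 : f w - (p * w + (f x - p * x)) = 0 := by
    have h1 : (y - x) * (f w - (p * w + (f x - p * x))) =
        (y - x) * f w - ((y - w) * f x + (w - x) * f y) := by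
      linear_combination (-(w - x)) * hpm
    have h2 := hnn w ⟨hw.1.le, hw.2.le⟩
    nlinarith
  have := hg.eq_zero_of_interior_zero hnn hw hw0 hz
  linarith

/-! ### Concave distortions -/

namespace ConcaveDistortion

variable (Ψ : ConcaveDistortion)

theorem nonneg {x : ℝ} (hx : x ∈ Icc (0 : ℝ) 1) : 0 ≤ Ψ x := (Ψ.mapsTo hx).1

theorem le_one {x : ℝ} (hx : x ∈ Icc (0 : ℝ) 1) : Ψ x ≤ 1 := (Ψ.mapsTo hx).2

theorem self_le {x : ℝ} (hx : x ∈ Icc (0 : ℝ) 1) : x ≤ Ψ x := by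
  have := Ψ.concaveOn.three_point (x := 0) (z := 1) (by simp) (by simp) hx.1 hx.2
  rw [Ψ.map_zero, Ψ.map_one] at this
  linarith

theorem pos {x : ℝ} (hx : x ∈ Ioc (0 : ℝ) 1) : 0 < Ψ x :=
  hx.1.trans_le (Ψ.self_le ⟨hx.1.le, hx.2⟩)

theorem mono {x y : ℝ} (hx : 0 ≤ x) (hxy : x ≤ y) (hy : y ≤ 1) : Ψ x ≤ Ψ y :=
  Ψ.monotoneOn ⟨hx, hxy.trans hy⟩ ⟨hx.trans hxy, hy⟩ hxy

/-- A concave distortion increases strictly as long as it has not reached `1`. -/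
theorem strict_of_lt_one {x y : ℝ} (hx : 0 ≤ x) (hxy : x < y) (hy : y ≤ 1) (h : Ψ x < 1) :
    Ψ x < Ψ y := by
  by_contra! hle
  have h3 := Ψ.concaveOn.three_point (x := x) (y := y) (z := 1) ⟨hx, hxy.le.trans hy⟩
    (by simp) hxy.le hy
  rw [Ψ.map_one] at h3
  nlinarith

theorem continuousAt {x : ℝ} (hx : x ∈ Ioo (0 : ℝ) 1) : ContinuousAt Ψ x := by
  have := Ψ.concaveOn.continuousOn_interior
  rw [interior_Icc] at this
  exact this.continuousAt (Ioo_mem_nhds hx.1 hx.2)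

theorem continuousOn_Ioc : ContinuousOn Ψ (Ioc 0 1) := by
  intro x hx
  rcases eq_or_lt_of_le hx.2 with h | h
  · subst h
    refine tendsto_of_tendsto_of_tendsto_of_le_of_le' (g := fun y => y) (h := fun _ => 1)
      ?_ ?_ ?_ ?_
    · rw [Ψ.map_one]; exact tendsto_id.mono_left nhdsWithin_le_nhds
    · rw [Ψ.map_one]; exact tendsto_const_nhds
    · filter_upwards [self_mem_nhdsWithin] with y hy using Ψ.self_le ⟨hy.1.le, hy.2⟩
    · filter_upwards [self_mem_nhdsWithin] with y hy using Ψ.le_one ⟨hy.1.le, hy.2⟩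
  · exact (Ψ.continuousAt ⟨hx.1, h⟩).continuousWithinAt

theorem concaveOn_sub_id : ConcaveOn ℝ (Icc 0 1) (fun x => Ψ x - x) :=
  Ψ.concaveOn.sub (convexOn_id (convex_Icc 0 1))

/-- `Ψ(x) - x` grows at most linearly: for `x ≤ y` it satisfies
`(Ψ(y) - y) / y ≤ (Ψ(x) - x) / x`. -/
theorem sub_self_mul_le {x y : ℝ} (hx : 0 ≤ x) (hxy : x ≤ y) (hy : y ≤ 1) :
    x * (Ψ y - y) ≤ y * (Ψ x - x) := by
  have := Ψ.concaveOn_sub_id.three_point (x := 0) (y := x) (z := y) (by simp)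
    ⟨hx.trans hxy, hy⟩ hx hxy
  rw [Ψ.map_zero] at this
  linarith

/-- Concave distortions are strongly subadditive. -/
theorem add_le_add_of_between {i p q s : ℝ} (hi : 0 ≤ i) (hip : i ≤ p) (hiq : i ≤ q)
    (hs : s ≤ 1) (h : i + s = p + q) : Ψ i + Ψ s ≤ Ψ p + Ψ q := by
  have his : i ≤ s := by linarith
  have h1 := Ψ.concaveOn.three_point (x := i) (y := p) (z := s) ⟨hi, by linarith⟩
    ⟨by linarith, hs⟩ hip (by linarith)
  have h2 := Ψ.concaveOn.three_point (x := i) (y := q) (z := s) ⟨hi, by linarith⟩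
    ⟨by linarith, hs⟩ hiq (by linarith)
  rcases eq_or_lt_of_le his with h' | h'
  · have e1 : p = i := by linarith
    have e2 : q = s := by linarith
    rw [e1, e2]
  · have : (s - i) * (Ψ i + Ψ s) ≤ (s - i) * (Ψ p + Ψ q) := by
      have : s = p + q - i := by linarith
      subst this
      linarith
    exact le_of_mul_le_mul_left this (sub_pos.2 h')

theorem add_lt_add_of_between (hΨ : StrictConcaveOn ℝ (Icc 0 1) Ψ) {i p q s : ℝ} (hi : 0 ≤ i)
    (hip : i < p) (hiq : i < q) (hs : s ≤ 1) (h : i + s = p + q) : Ψ i + Ψ s < Ψ p + Ψ q := by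
  have his : 0 < s - i := by linarith
  have key : ∀ r, i < r → r < s → (s - r) * Ψ i + (r - i) * Ψ s < (s - i) * Ψ r := by
    intro r h1 h2
    have := hΨ.2 (show i ∈ Icc (0 : ℝ) 1 from ⟨hi, by linarith⟩)
      (show s ∈ Icc (0 : ℝ) 1 from ⟨by linarith, hs⟩) (by linarith)
      (show 0 < (s - r) / (s - i) from div_pos (by linarith) his)
      (show 0 < (r - i) / (s - i) from div_pos (by linarith) his) (by field_simp; ring)
    simp only [smul_eq_mul] at this
    have e : (s - r) / (s - i) * i + (r - i) / (s - i) * s = r := by field_simp; ring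
    rw [e] at this
    have e2 : (s - i) * ((s - r) / (s - i) * Ψ i + (r - i) / (s - i) * Ψ s)
        = (s - r) * Ψ i + (r - i) * Ψ s := by field_simp
    rw [← e2]
    exact mul_lt_mul_of_pos_left this his
  have h1 := key p hip (by linarith)
  have h2 := key q hiq (by linarith)
  refine lt_of_mul_lt_mul_left ?_ his.le
  have : s = p + q - i := by linarith
  subst this
  linarith

end ConcaveDistortion

/-! ### The semigroup and its orbits -/

section Semigroup

variable {Ψ : ℝ≥0 → ConcaveDistortion}

namespace IsDistortionSemigroup

theorem monotone_time (hΨ : IsDistortionSemigroup Ψ) {s t : ℝ≥0} (hst : s ≤ t) {x : ℝ}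
    (hx : x ∈ Icc (0 : ℝ) 1) : Ψ s x ≤ Ψ t x := by
  have := hΨ (t - s) s x hx
  rw [tsub_add_cancel_of_le hst] at this
  rw [← this]
  exact (Ψ (t - s)).self_le ((Ψ s).mapsTo hx)

/-- In a nontrivial semigroup the infimum over positive times is the identity. An infimum
`y > x` would be fixed by the infimum distortion; concavity forces `y = 1`, and then
`Ψ_t = 1` on `(0,1]` for all `t > 0`. -/
theorem exists_lt_add (hΨ : IsDistortionSemigroup Ψ) (hΨ' : IsNontrivialFamily Ψ) {x : ℝ}
    (hx : x ∈ Icc (0 : ℝ) 1) {ε : ℝ} (hε : 0 < ε) : ∃ t : ℝ≥0, 0 < t ∧ Ψ t x < x + ε := by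
  by_contra! hcon
  have hx0 : x ≠ 0 := by
    rintro rfl
    have := hcon 1 one_pos
    rw [(Ψ 1).map_zero] at this
    linarith
  have hx1 : x < 1 := by
    have := hcon 1 one_pos
    have := (Ψ 1).le_one hx
    linarith
  have hxp : 0 < x := lt_of_le_of_ne hx.1 (Ne.symm hx0)
  -- `L` is the infimum over positive times
  let L : ℝ → ℝ := fun z => ⨅ t : {t : ℝ≥0 // 0 < t}, Ψ t z
  have : Nonempty {t : ℝ≥0 // 0 < t} := ⟨⟨1, one_pos⟩⟩
  have hbdd : ∀ z ∈ Icc (0 : ℝ) 1, BddBelow (range fun t : {t : ℝ≥0 // 0 < t} => Ψ t z) :=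
    fun z hz => ⟨0, by rintro _ ⟨t, rfl⟩; exact (Ψ t).nonneg hz⟩
  have hLle : ∀ z ∈ Icc (0 : ℝ) 1, ∀ t : ℝ≥0, 0 < t → L z ≤ Ψ t z :=
    fun z hz t ht => ciInf_le (hbdd z hz) ⟨t, ht⟩
  have hleL : ∀ z c : ℝ, (∀ t : ℝ≥0, 0 < t → c ≤ Ψ t z) → c ≤ L z :=
    fun z c h => le_ciInf fun t => h t t.2
  set y := L x with hy
  have hxy : x + ε ≤ y := hleL _ _ hcon
  have hy1 : y ≤ 1 := (hLle x hx 1 one_pos).trans ((Ψ 1).le_one hx)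
  have hyI : y ∈ Icc (0 : ℝ) 1 := ⟨by linarith [hx.1], hy1⟩
  have hLy : L y ≤ y := by
    refine hleL _ _ fun t ht => ?_
    have ht2 : 0 < t / 2 := half_pos ht
    have h1 := hΨ (t / 2) (t / 2) x hx
    rw [add_halves] at h1
    rw [← h1]
    refine (hLle y hyI _ ht2).trans ((Ψ _).mono hyI.1 (hLle x hx _ ht2) ((Ψ _).le_one hx))
  have hy1' : y = 1 := by
    by_contra hne
    have hlt : y < 1 := lt_of_le_of_ne hy1 hne
    have h3 : ((1 - y) * y + (y - x)) / (1 - x) ≤ L y := by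
      refine hleL _ _ fun t ht => ?_
      rw [div_le_iff₀ (by linarith)]
      have := (Ψ t).concaveOn.three_point (x := x) (y := y) (z := 1) hx (by simp) (by linarith) hy1
      rw [(Ψ t).map_one] at this
      have h4 := mul_le_mul_of_nonneg_left (hLle x hx t ht) (sub_nonneg.2 hy1)
      linarith
    have h5 := h3.trans hLy
    rw [div_le_iff₀ (by linarith)] at h5
    nlinarith
  have hone : ∀ t : ℝ≥0, 0 < t → Ψ t x = 1 := fun t ht =>
    le_antisymm ((Ψ t).le_one hx) (hy1' ▸ hLle x hx t ht)
  -- the flat piece of `Ψ_t` extends down to `0`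
  have hpush : ∀ z ∈ Ioo (0 : ℝ) x, ∀ t : ℝ≥0, 0 < t → Ψ t z = 1 := by
    intro z hz t ht
    have hzI : z ∈ Icc (0 : ℝ) 1 := ⟨hz.1.le, by linarith [hz.2]⟩
    have hlow : ∀ s : ℝ≥0, 0 < s → z / x ≤ Ψ s z := by
      intro s hs
      have := (Ψ s).concaveOn.three_point (x := 0) (y := z) (z := x) (by simp) hx hz.1.le hz.2.le
      rw [(Ψ s).map_zero, hone s hs] at this
      rw [div_le_iff₀ hxp]
      linarith
    -- each halving of the time, `Ψ_s = Ψ_{s/2} ∘ Ψ_{s/2}`, multiplies the lower bound by `1/x`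
    have hiter : ∀ n : ℕ, ∀ s : ℝ≥0, 0 < s → min 1 (z / x ^ n) ≤ Ψ s z := by
      intro n
      induction n with
      | zero => intro s hs; simpa [min_eq_right (hzI.2)] using (Ψ s).self_le hzI
      | succ n ih =>
        intro s hs
        have hs2 : 0 < s / 2 := half_pos hs
        have h1 := hΨ (s / 2) (s / 2) z hzI
        rw [add_halves] at h1
        rw [← h1]
        set w := Ψ (s / 2) z with hw
        have hwI : w ∈ Icc (0 : ℝ) 1 := (Ψ _).mapsTo hzI
        rcases le_total x w with hxw | hxw
        · refine (min_le_left _ _).trans ?_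
          rw [← hone _ hs2]
          exact (Ψ _).mono hx.1 hxw hwI.2
        · have h2 := (Ψ (s / 2)).concaveOn.three_point (x := 0) (y := w) (z := x) (by simp) hx
            hwI.1 hxw
          rw [(Ψ _).map_zero, hone _ hs2] at h2
          have h3 : w / x ≤ Ψ (s / 2) w := by
            rw [div_le_iff₀ hxp]; linarith
          refine le_trans ?_ h3
          have h4 := ih (s / 2) hs2
          rw [← hw] at h4
          have hn : z / x ^ n ≤ w := by
            rcases min_le_iff.1 h4 with h5 | h5
            · linarith
            · exact h5
          refine (min_le_right _ _).trans ?_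
          rw [pow_succ, ← div_div]
          exact div_le_div_of_nonneg_right hn hxp.le
    obtain ⟨n, hn⟩ := exists_pow_lt_of_lt_one hz.1 hx1
    have h1 := hiter n t ht
    rw [min_eq_left] at h1
    · exact le_antisymm ((Ψ t).le_one hzI) h1
    · rw [le_div_iff₀ (pow_pos hxp n)]; linarith
  refine hΨ'.2 fun t ht z hz => ?_
  rcases lt_or_ge z x with h | h
  · exact hpush z ⟨hz.1, h⟩ t ht
  · exact le_antisymm ((Ψ t).le_one ⟨hz.1.le, hz.2⟩) (hone t ht ▸ (Ψ t).mono hx.1 h hz.2)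

theorem zero_apply (hΨ : IsDistortionSemigroup Ψ) (hΨ' : IsNontrivialFamily Ψ) {x : ℝ}
    (hx : x ∈ Icc (0 : ℝ) 1) : Ψ 0 x = x := by
  refine le_antisymm (le_of_forall_pos_le_add fun ε hε => ?_) ((Ψ 0).self_le hx)
  obtain ⟨t, -, h⟩ := hΨ.exists_lt_add hΨ' hx hε
  exact (hΨ.monotone_time zero_le hx).trans h.le

theorem sub_le_div (hΨ : IsDistortionSemigroup Ψ) {s t : ℝ≥0} (hst : s ≤ t) {x : ℝ}
    (hx : x ∈ Ioc (0 : ℝ) 1) : Ψ t x - Ψ s x ≤ (Ψ (t - s) x - x) / x := by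
  have hxI : x ∈ Icc (0 : ℝ) 1 := ⟨hx.1.le, hx.2⟩
  have h := hΨ (t - s) s x hxI
  rw [tsub_add_cancel_of_le hst] at h
  rw [← h, le_div_iff₀ hx.1]
  have h1 := (Ψ (t - s)).sub_self_mul_le hx.1.le ((Ψ s).self_le hxI) ((Ψ s).le_one hxI)
  have h2 := (Ψ s).le_one hxI
  have h3 := (Ψ (t - s)).self_le hxI
  nlinarith

theorem continuous_time (hΨ : IsDistortionSemigroup Ψ) (hΨ' : IsNontrivialFamily Ψ) {x : ℝ}
    (hx : x ∈ Icc (0 : ℝ) 1) : Continuous fun t : ℝ≥0 => Ψ t x := by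
  rcases eq_or_lt_of_le hx.1 with h0 | h0
  · subst h0
    simp only [ConcaveDistortion.map_zero]
    exact continuous_const
  rw [Metric.continuous_iff]
  intro t ε hε
  obtain ⟨δ, hδ, hlt⟩ := hΨ.exists_lt_add hΨ' hx (mul_pos h0 hε)
  have key : ∀ s t : ℝ≥0, s ≤ t → t - s ≤ δ → Ψ t x - Ψ s x < ε := by
    intro s t hst hd
    refine (hΨ.sub_le_div hst ⟨h0, hx.2⟩).trans_lt ?_
    rw [div_lt_iff₀ h0]
    have := hΨ.monotone_time hd hx
    linarith
  refine ⟨δ, hδ, fun s hs => ?_⟩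
  rw [NNReal.dist_eq] at hs
  rw [Real.dist_eq]
  rcases le_total s t with hst | hst
  · have h1 := hΨ.monotone_time hst hx
    rw [abs_of_nonpos (by linarith)]
    have := key s t hst (by
      rw [← NNReal.coe_le_coe, NNReal.coe_sub hst]
      linarith [(abs_lt.1 hs).1])
    linarith
  · have h1 := hΨ.monotone_time hst hx
    rw [abs_of_nonneg (by linarith)]
    exact key t s hst (by
      rw [← NNReal.coe_le_coe, NNReal.coe_sub hst]
      linarith [(abs_lt.1 hs).2])

theorem self_lt (hΨ : IsDistortionSemigroup Ψ) (hΨ' : IsNontrivialFamily Ψ) {t : ℝ≥0}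
    (ht : 0 < t) {x : ℝ} (hx : x ∈ Ioo (0 : ℝ) 1) : x < Ψ t x := by
  refine lt_of_le_of_ne ((Ψ t).self_le ⟨hx.1.le, hx.2.le⟩) fun heq => hΨ'.1 ?_
  have hid : ∀ z ∈ Icc (0 : ℝ) 1, Ψ t z = z := fun z hz => sub_eq_zero.1 <|
    (Ψ t).concaveOn_sub_id.eq_zero_of_interior_zero
      (fun y hy => sub_nonneg.2 ((Ψ t).self_le hy)) hx (by linarith) hz
  have hn : ∀ n : ℕ, ∀ z ∈ Icc (0 : ℝ) 1, Ψ (n * t) z = z := by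
    intro n
    induction n with
    | zero => intro z hz; simpa using hΨ.zero_apply hΨ' hz
    | succ n ih =>
      intro z hz
      rw [Nat.cast_succ, add_mul, one_mul, ← hΨ _ _ z hz, hid z hz, ih z hz]
  intro s z hz
  obtain ⟨n, hsn⟩ := Archimedean.arch s ht
  rw [nsmul_eq_mul] at hsn
  exact le_antisymm ((hΨ.monotone_time hsn hz).trans (hn n z hz).le) ((Ψ s).self_le hz)

theorem strict_time (hΨ : IsDistortionSemigroup Ψ) (hΨ' : IsNontrivialFamily Ψ) {s t : ℝ≥0}
    (hst : s < t) {x : ℝ} (hx : x ∈ Ioc (0 : ℝ) 1) (h1 : Ψ s x < 1) : Ψ s x < Ψ t x := by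
  have h := hΨ (t - s) s x ⟨hx.1.le, hx.2⟩
  rw [tsub_add_cancel_of_le hst.le] at h
  rw [← h]
  exact hΨ.self_lt hΨ' (tsub_pos_of_lt hst) ⟨(Ψ s).pos hx, h1⟩

/-- The orbit of `x ∈ (0,1)` runs through all of `[x, 1)`. -/
theorem exists_time_eq (hΨ : IsDistortionSemigroup Ψ) (hΨ' : IsNontrivialFamily Ψ) {x z : ℝ}
    (hx : 0 < x) (hxz : x ≤ z) (hz : z < 1) : ∃ t : ℝ≥0, Ψ t x = z := by
  have hxI : x ∈ Icc (0 : ℝ) 1 := ⟨hx.le, by linarith⟩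
  have hex : ∃ n : ℕ, z ≤ Ψ (n : ℝ≥0) x := by
    by_contra! hcon
    have hmono : Monotone fun n : ℕ => Ψ (n : ℝ≥0) x := fun m n hmn =>
      hΨ.monotone_time (by exact_mod_cast hmn) hxI
    have hbd : BddAbove (range fun n : ℕ => Ψ (n : ℝ≥0) x) :=
      ⟨z, by rintro _ ⟨n, rfl⟩; exact (hcon n).le⟩
    have hlim := tendsto_atTop_ciSup hmono hbd
    set S := ⨆ n : ℕ, Ψ (n : ℝ≥0) x
    have hxS : x ≤ S := by
      have := le_ciSup hbd 0
      simp only [Nat.cast_zero] at this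
      exact ((Ψ 0).self_le hxI).trans this
    have hSz : S ≤ z := ciSup_le fun n => (hcon n).le
    have hS : S ∈ Ioo (0 : ℝ) 1 := ⟨by linarith, by linarith⟩
    have h1 : Tendsto (fun n : ℕ => Ψ 1 (Ψ (n : ℝ≥0) x)) atTop (𝓝 (Ψ 1 S)) :=
      ((Ψ 1).continuousAt hS).tendsto.comp hlim
    have h2 : Tendsto (fun n : ℕ => Ψ 1 (Ψ (n : ℝ≥0) x)) atTop (𝓝 S) := by
      have := hlim.comp (tendsto_add_atTop_nat 1)
      refine this.congr fun n => ?_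
      simp only [Function.comp]
      rw [hΨ 1 n x hxI, Nat.cast_succ, add_comm]
    exact (hΨ.self_lt hΨ' one_pos hS).ne (tendsto_nhds_unique h2 h1)
  obtain ⟨n, hn⟩ := hex
  have := intermediate_value_Icc (a := (0 : ℝ≥0)) (b := n) zero_le
    (hΨ.continuous_time hΨ' hxI).continuousOn
  obtain ⟨t, -, ht⟩ := this ⟨by rw [hΨ.zero_apply hΨ' hxI]; exact hxz, hn⟩
  exact ⟨t, ht⟩

end IsDistortionSemigroup

end Semigroup

/-! ### The generator and its differential equation -/

section Generator

variable {Ψ : ℝ≥0 → ConcaveDistortion}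

namespace IsDistortionSemigroup

/-- The limit defining the generator exists on `(0,1)`. An orbit is monotone in time, hence
differentiable at some time, which gives the limit at some `y < x`; the right derivative of the
concave distortion that maps `y` to `x` carries the limit from `y` to `x`. -/
theorem tendsto_generator (hΨ : IsDistortionSemigroup Ψ) (hΨ' : IsNontrivialFamily Ψ) {x : ℝ}
    (hx : x ∈ Ioo (0 : ℝ) 1) :
    Tendsto (fun t : ℝ≥0 => (Ψ t x - x) / (t : ℝ)) (𝓝[>] 0) (𝓝 (generator Ψ x)) := by
  refine tendsto_nhds_limUnder ?_
  have hx2 : x / 2 ∈ Icc (0 : ℝ) 1 := ⟨by linarith [hx.1], by linarith [hx.1, hx.2]⟩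
  obtain ⟨s, hs⟩ := hΨ.exists_time_eq hΨ' (x := x / 2) (z := x) (by linarith [hx.1])
    (by linarith [hx.1]) hx.2
  have hs0 : 0 < s := by
    rw [pos_iff_ne_zero]
    rintro rfl
    rw [hΨ.zero_apply hΨ' hx2] at hs
    linarith [hx.1]
  let φ : ℝ → ℝ := fun t => Ψ t.toNNReal (x / 2)
  have hφ : Monotone φ := fun a b hab => hΨ.monotone_time (Real.toNNReal_mono hab) hx2
  obtain ⟨τ, hτ, hdiff⟩ : ∃ τ ∈ Ioo (0 : ℝ) s, DifferentiableAt ℝ φ τ := by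
    by_contra! hcon
    have h0 : volume (Ioo (0 : ℝ) s) = 0 := measure_mono_null hcon hφ.ae_differentiableAt
    rw [Real.volume_Ioo, ENNReal.ofReal_eq_zero, sub_zero] at h0
    exact absurd hs0 (not_lt.2 (by exact_mod_cast h0))
  set τ' := τ.toNNReal with hτ'
  have hτc : (τ' : ℝ) = τ := Real.coe_toNNReal τ hτ.1.le
  have hτs : τ' ≤ s := by rw [← NNReal.coe_le_coe, hτc]; exact hτ.2.le
  set y := Ψ τ' (x / 2) with hy
  set r := s - τ' with hr
  have hyx : Ψ r y = x := by
    rw [hy, hΨ _ _ _ hx2, hr, tsub_add_cancel_of_le hτs, hs]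
  have hyI : y ∈ Ioo (0 : ℝ) 1 :=
    ⟨(Ψ τ').pos ⟨by linarith [hx.1], hx2.2⟩, by
      have := (Ψ r).self_le ((Ψ τ').mapsTo hx2)
      rw [← hy, hyx] at this
      linarith [hx.2]⟩
  have hyI' : y ∈ Icc (0 : ℝ) 1 := ⟨hyI.1.le, hyI.2.le⟩
  have hcoe : Tendsto (fun h : ℝ≥0 => (h : ℝ)) (𝓝[>] 0) (𝓝[≠] 0) := by
    refine tendsto_nhdsWithin_iff.2 ⟨?_, ?_⟩
    · exact (NNReal.continuous_coe.tendsto 0).mono_left nhdsWithin_le_nhds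
    · filter_upwards [self_mem_nhdsWithin] with h hh
      simpa using (ne_of_gt hh : h ≠ 0)
  have h1 : Tendsto (fun h : ℝ≥0 => (Ψ h y - y) / (h : ℝ)) (𝓝[>] 0) (𝓝 (deriv φ τ)) := by
    refine ((hasDerivAt_iff_tendsto_slope_zero.1 hdiff.hasDerivAt).comp hcoe).congr fun h => ?_
    have e : (τ + h).toNNReal = h + τ' := by
      rw [Real.toNNReal_add hτ.1.le h.coe_nonneg, Real.toNNReal_coe, add_comm]
    simp only [Function.comp, smul_eq_mul, φ]
    rw [e, ← hΨ _ _ _ hx2, ← hy, div_eq_inv_mul]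
  have h2 : Tendsto (fun h : ℝ≥0 => Ψ h y) (𝓝[>] 0) (𝓝[>] y) := by
    refine tendsto_nhdsWithin_iff.2 ⟨?_, ?_⟩
    · have := (hΨ.continuous_time hΨ' hyI').tendsto 0
      rw [hΨ.zero_apply hΨ' hyI'] at this
      exact this.mono_left nhdsWithin_le_nhds
    · filter_upwards [self_mem_nhdsWithin] with h hh using hΨ.self_lt hΨ' hh hyI
  have h3 : HasDerivWithinAt (Ψ r) (derivWithin (Ψ r) (Ioi y) y) (Ioi y) y := by
    have := (Ψ r).concaveOn.neg.differentiableWithinAt_Ioi_of_mem_interior (x := y)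
      (by rw [interior_Icc]; exact hyI)
    have h4 := this.neg
    simp only [neg_neg] at h4
    exact h4.hasDerivWithinAt
  have h4 := ((hasDerivWithinAt_iff_tendsto_slope' self_notMem_Ioi).1 h3).comp h2
  refine ⟨_, (h4.mul h1).congr' ?_⟩
  filter_upwards [self_mem_nhdsWithin] with h hh
  have h5 : Ψ h y - y ≠ 0 := (sub_pos.2 (hΨ.self_lt hΨ' hh hyI)).ne'
  simp only [Function.comp, slope_def_field]
  rw [hΨ r h y hyI', add_comm r h, ← hΨ h r y hyI', hyx]
  field_simp

theorem generator_nonneg (hΨ : IsDistortionSemigroup Ψ) (hΨ' : IsNontrivialFamily Ψ) {x : ℝ}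
    (hx : x ∈ Ioo (0 : ℝ) 1) : 0 ≤ generator Ψ x :=
  ge_of_tendsto' (hΨ.tendsto_generator hΨ' hx) fun t =>
    div_nonneg (sub_nonneg.2 ((Ψ t).self_le ⟨hx.1.le, hx.2.le⟩)) t.2

theorem concaveOn_generator (hΨ : IsDistortionSemigroup Ψ) (hΨ' : IsNontrivialFamily Ψ) :
    ConcaveOn ℝ (Ioo 0 1) (generator Ψ) := by
  refine ⟨convex_Ioo 0 1, fun x hx y hy a b ha hb hab => ?_⟩
  have hz := convex_Ioo (0 : ℝ) 1 hx hy ha hb hab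
  refine le_of_tendsto_of_tendsto' (((hΨ.tendsto_generator hΨ' hx).const_smul a).add
    ((hΨ.tendsto_generator hΨ' hy).const_smul b)) (hΨ.tendsto_generator hΨ' hz) fun t => ?_
  have := (Ψ t).concaveOn.2 (Ioo_subset_Icc_self hx) (Ioo_subset_Icc_self hy) ha hb hab
  simp only [smul_eq_mul] at this ⊢
  rw [← mul_div_assoc, ← mul_div_assoc, ← add_div]
  exact div_le_div_of_nonneg_right (by linarith) t.2

theorem continuousOn_generator (hΨ : IsDistortionSemigroup Ψ) (hΨ' : IsNontrivialFamily Ψ) :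
    ContinuousOn (generator Ψ) (Ioo 0 1) :=
  (hΨ.concaveOn_generator hΨ').continuousOn isOpen_Ioo

/-- Until it reaches `1`, an orbit solves the differential equation `y' = G(y)`, in the sense of
right derivatives. -/
theorem hasDerivWithinAt_orbit (hΨ : IsDistortionSemigroup Ψ) (hΨ' : IsNontrivialFamily Ψ) {x : ℝ}
    (hx : x ∈ Ioo (0 : ℝ) 1) {t : ℝ} (ht : 0 ≤ t) (h1 : Ψ t.toNNReal x < 1) :
    HasDerivWithinAt (fun t : ℝ => Ψ t.toNNReal x) (generator Ψ (Ψ t.toNNReal x)) (Ici t) t := by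
  have hxI : x ∈ Icc (0 : ℝ) 1 := ⟨hx.1.le, hx.2.le⟩
  rw [← hasDerivWithinAt_Ioi_iff_Ici, hasDerivWithinAt_iff_tendsto_slope' self_notMem_Ioi]
  have hy : Ψ t.toNNReal x ∈ Ioo (0 : ℝ) 1 := ⟨(Ψ _).pos ⟨hx.1, hx.2.le⟩, h1⟩
  have h2 : Tendsto (fun u : ℝ => (u - t).toNNReal) (𝓝[>] t) (𝓝[>] 0) := by
    refine tendsto_nhdsWithin_iff.2 ⟨?_, ?_⟩
    · have : Continuous fun u : ℝ => (u - t).toNNReal := by fun_prop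
      have := this.tendsto t
      simp only [sub_self, Real.toNNReal_zero] at this
      exact this.mono_left nhdsWithin_le_nhds
    · filter_upwards [self_mem_nhdsWithin] with u hu
      simpa using hu
  refine ((hΨ.tendsto_generator hΨ' hy).comp h2).congr' ?_
  filter_upwards [self_mem_nhdsWithin] with u hu
  have hut : 0 ≤ u - t := sub_nonneg.2 (le_of_lt hu)
  simp only [Function.comp, slope_def_field]
  rw [Real.coe_toNNReal _ hut, hΨ _ _ _ hxI, ← Real.toNNReal_add hut ht, sub_add_cancel]

theorem continuous_orbit (hΨ : IsDistortionSemigroup Ψ) (hΨ' : IsNontrivialFamily Ψ) {x : ℝ}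
    (hx : x ∈ Icc (0 : ℝ) 1) : Continuous fun t : ℝ => Ψ t.toNNReal x :=
  (hΨ.continuous_time hΨ' hx).comp continuous_real_toNNReal

theorem generator_pos (hΨ : IsDistortionSemigroup Ψ) (hΨ' : IsNontrivialFamily Ψ) {x : ℝ}
    (hx : x ∈ Ioo (0 : ℝ) 1) : 0 < generator Ψ x := by
  refine lt_of_le_of_ne (hΨ.generator_nonneg hΨ' hx) fun h0 => ?_
  have hG : ∀ z ∈ Ioo (0 : ℝ) 1, generator Ψ z = 0 := by
    intro z hz
    have ha : 0 < min x z := lt_min hx.1 hz.1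
    have hb : max x z < 1 := max_lt hx.2 hz.2
    have hsub : Icc (min x z / 2) ((1 + max x z) / 2) ⊆ Ioo (0 : ℝ) 1 := fun u hu =>
      ⟨by linarith [hu.1], by linarith [hu.2]⟩
    refine ((hΨ.concaveOn_generator hΨ').subset hsub (convex_Icc _ _)).eq_zero_of_interior_zero
      (fun u hu => hΨ.generator_nonneg hΨ' (hsub hu)) (w := x) ⟨?_, ?_⟩ h0.symm ⟨?_, ?_⟩
    · linarith [min_le_left x z]
    · linarith [le_max_left x z]
    · linarith [min_le_right x z]
    · linarith [le_max_right x z]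
  have hxI : x ∈ Icc (0 : ℝ) 1 := ⟨hx.1.le, hx.2.le⟩
  have hz : x < (x + 1) / 2 := by linarith [hx.2]
  obtain ⟨T, hT⟩ := hΨ.exists_time_eq hΨ' hx.1 hz.le (by linarith [hx.2])
  have hconst := constant_of_has_deriv_right_zero (a := (0 : ℝ)) (b := T)
    (hΨ.continuous_orbit hΨ' hxI).continuousOn (by
      intro t ht
      have hle : Ψ t.toNNReal x ≤ Ψ T x :=
        hΨ.monotone_time (Real.toNNReal_le_iff_le_coe.2 ht.2.le) hxI
      have hlt : Ψ t.toNNReal x < 1 := by rw [hT] at hle; linarith [hx.2]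
      have := hΨ.hasDerivWithinAt_orbit hΨ' hx ht.1 hlt
      rwa [hG _ ⟨(Ψ _).pos ⟨hx.1, hx.2.le⟩, hlt⟩] at this) T ⟨T.2, le_rfl⟩
  simp only [Real.toNNReal_coe, Real.toNNReal_zero] at hconst
  rw [hT, hΨ.zero_apply hΨ' hxI] at hconst
  linarith

/-- The travel time from `x` to `Ψ_t(x)` is `t`: it is the integral of `1 / G`. -/
theorem lintegral_inv_generator (hΨ : IsDistortionSemigroup Ψ) (hΨ' : IsNontrivialFamily Ψ)
    {x : ℝ} (hx : x ∈ Ioo (0 : ℝ) 1) (T : ℝ≥0) (h1 : Ψ T x < 1) :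
    ∫⁻ s in Ioc x (Ψ T x), ENNReal.ofReal (1 / generator Ψ s) = T := by
  have hxI : x ∈ Icc (0 : ℝ) 1 := ⟨hx.1.le, hx.2.le⟩
  have hcont : ContinuousOn (fun s => 1 / generator Ψ s) (Ioo 0 1) :=
    continuousOn_const.div (hΨ.continuousOn_generator hΨ') fun s hs =>
      (hΨ.generator_pos hΨ' hs).ne'
  have hsub : ∀ z ∈ Ioo (0 : ℝ) 1, uIcc x z ⊆ Ioo (0 : ℝ) 1 := fun z hz =>
    (convex_Ioo (0 : ℝ) 1).ordConnected.uIcc_subset hx hz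
  have hII : ∀ z ∈ Ioo (0 : ℝ) 1,
      IntervalIntegrable (fun s => 1 / generator Ψ s) volume x z := fun z hz =>
    (hcont.mono (hsub z hz)).intervalIntegrable
  let H : ℝ → ℝ := fun z => ∫ s in x..z, 1 / generator Ψ s
  have hH : ∀ z ∈ Ioo (0 : ℝ) 1, HasDerivAt H (1 / generator Ψ z) z := fun z hz =>
    intervalIntegral.integral_hasDerivAt_right (hII z hz)
      (hcont.stronglyMeasurableAtFilter isOpen_Ioo z hz)
      (hcont.continuousAt (Ioo_mem_nhds hz.1 hz.2))
  have horb : ∀ t : ℝ, t ≤ T → Ψ t.toNNReal x ∈ Ioo (0 : ℝ) 1 := fun t ht =>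
    ⟨(Ψ _).pos ⟨hx.1, hx.2.le⟩,
      (hΨ.monotone_time (Real.toNNReal_le_iff_le_coe.2 ht) hxI).trans_lt h1⟩
  have hconst := constant_of_has_deriv_right_zero (a := (0 : ℝ)) (b := T)
    (f := fun t => H (Ψ t.toNNReal x) - t)
    (by
      refine ContinuousOn.sub ?_ continuousOn_id
      intro t ht
      exact (ContinuousAt.comp (g := H) (f := fun t : ℝ => Ψ t.toNNReal x)
        (hH _ (horb t ht.2)).continuousAt
        (hΨ.continuous_orbit hΨ' hxI).continuousAt).continuousWithinAt)
    (by
      intro t ht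
      have hm := horb t ht.2.le
      have := ((hH _ hm).comp_hasDerivWithinAt t
        (hΨ.hasDerivWithinAt_orbit hΨ' hx ht.1 hm.2)).sub (hasDerivWithinAt_id t (Ici t))
      rwa [one_div, inv_mul_cancel₀ (hΨ.generator_pos hΨ' hm).ne', sub_self] at this)
    T ⟨T.2, le_rfl⟩
  simp only [Real.toNNReal_coe, Real.toNNReal_zero, hΨ.zero_apply hΨ' hxI, sub_zero] at hconst
  have hTm : Ψ T x ∈ Ioo (0 : ℝ) 1 := by simpa using horb T le_rfl
  have hle : x ≤ Ψ T x := (Ψ T).self_le hxI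
  have hval : ∫ s in Ioc x (Ψ T x), 1 / generator Ψ s = T := by
    rw [← intervalIntegral.integral_of_le hle]
    have : H x = 0 := intervalIntegral.integral_same
    linarith
  rw [← ofReal_integral_eq_lintegral_ofReal ((hII _ hTm).1), hval, ENNReal.ofReal_coe_nnreal]
  refine (ae_restrict_iff' measurableSet_Ioc).2 (ae_of_all _ fun s hs => ?_)
  exact one_div_nonneg.2 (hΨ.generator_nonneg hΨ' ⟨hx.1.trans hs.1, hs.2.trans_lt h1⟩)

/-- The travel time from `x` to `1` is infinite if and only if the orbit of `x` never reaches
`1`. -/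
theorem lintegral_inv_generator_eq_top_iff (hΨ : IsDistortionSemigroup Ψ)
    (hΨ' : IsNontrivialFamily Ψ) {x : ℝ} (hx : x ∈ Ioo (0 : ℝ) 1) :
    ∫⁻ s in Ioo x 1, ENNReal.ofReal (1 / generator Ψ s) = ⊤ ↔ ∀ t : ℝ≥0, Ψ t x < 1 := by
  have hxI : x ∈ Icc (0 : ℝ) 1 := ⟨hx.1.le, hx.2.le⟩
  constructor
  · intro htop T
    refine lt_of_le_of_ne ((Ψ T).le_one hxI) fun hT => ?_
    have hle : ∀ z ∈ Ico x 1, ∫⁻ s in Ioc x z, ENNReal.ofReal (1 / generator Ψ s) ≤ T := by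
      intro z hz
      obtain ⟨t, ht⟩ := hΨ.exists_time_eq hΨ' hx.1 hz.1 hz.2
      have htT : t ≤ T := by
        by_contra! hlt
        have := hΨ.monotone_time hlt.le hxI
        rw [hT, ht] at this
        linarith [hz.2]
      rw [← ht, hΨ.lintegral_inv_generator hΨ' hx t (by rw [ht]; exact hz.2)]
      exact_mod_cast htT
    obtain ⟨u, humono, hu1, hulim⟩ := exists_seq_strictMono_tendsto' hx.2
    have hU : Ioo x 1 = ⋃ n, Ioc x (u n) := by
      ext s
      simp only [mem_iUnion, mem_Ioo, mem_Ioc]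
      constructor
      · rintro ⟨h1, h2⟩
        obtain ⟨n, hn⟩ := (hulim.eventually (lt_mem_nhds h2)).exists
        exact ⟨n, h1, hn.le⟩
      · rintro ⟨n, h1, h2⟩
        exact ⟨h1, h2.trans_lt (hu1 n).2⟩
    rw [hU, setLIntegral_iUnion_of_directed] at htop
    · have : (⊤ : ℝ≥0∞) ≤ T := htop ▸ iSup_le fun n => hle _ ⟨(hu1 n).1.le, (hu1 n).2⟩
      exact absurd this (by simp)
    · exact (monotone_nat_of_le_succ fun n =>
        Ioc_subset_Ioc_right (humono.monotone (Nat.le_succ n))).directed_le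
  · intro hlt
    refine ENNReal.eq_top_of_forall_nnreal_le fun t => ?_
    rw [← hΨ.lintegral_inv_generator hΨ' hx t (hlt t)]
    exact lintegral_mono_set fun s hs => ⟨hs.1, hs.2.trans_lt (hlt t)⟩

/-! ### Strict concavity of the distortions and of the generator -/

/-- If the generator is affine on an interval, the linear differential equation there makes `Ψ_t`
affine on a smaller interval for small `t`. -/
theorem strictConcaveOn_generator (hΨ : IsDistortionSemigroup Ψ) (hΨ' : IsNontrivialFamily Ψ)
    (hs : ∀ t : ℝ≥0, 0 < t → StrictConcaveOn ℝ (Icc 0 1) (Ψ t)) :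
    StrictConcaveOn ℝ (Ioo 0 1) (generator Ψ) := by
  by_contra hns
  obtain ⟨a, b, p, q, ha, hb, hab, hG⟩ :=
    (hΨ.concaveOn_generator hΨ').exists_affine_of_not_strict hns
  set c := (a + b) / 2 with hc
  have hac : a < c := by linarith
  have hcb : c < b := by linarith
  have hcI : c ∈ Ioo (0 : ℝ) 1 := ⟨by linarith [ha.1], by linarith [hb.2]⟩
  set m := (a + c) / 2 with hm
  have hmI : m ∈ Ioo (0 : ℝ) 1 := ⟨by linarith [ha.1], by linarith [hb.2]⟩
  obtain ⟨T, hT0, hT⟩ := hΨ.exists_lt_add hΨ' (Ioo_subset_Icc_self hcI) (ε := b - c)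
    (by linarith)
  have hmem : ∀ z, a ≤ z → z ≤ c → ∀ t : ℝ, t ≤ T → Ψ t.toNNReal z ∈ Icc a b := by
    intro z h1 h2 t ht
    have hz : z ∈ Icc (0 : ℝ) 1 := ⟨by linarith [ha.1], by linarith [hcI.2]⟩
    refine ⟨h1.trans ((Ψ _).self_le hz), ?_⟩
    have h3 := (Ψ t.toNNReal).mono hz.1 h2 hcI.2.le
    have h4 := hΨ.monotone_time (Real.toNNReal_le_iff_le_coe.2 ht) (Ioo_subset_Icc_self hcI)
    linarith
  have hder : ∀ z, a ≤ z → z ≤ c → z ∈ Ioo (0 : ℝ) 1 → ∀ t : ℝ, 0 ≤ t → t ≤ T →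
      HasDerivWithinAt (fun t : ℝ => Ψ t.toNNReal z) (p * Ψ t.toNNReal z + q) (Ici t) t := by
    intro z h1 h2 hz t h3 h4
    have h5 := hmem z h1 h2 t h4
    rw [← hG _ h5]
    exact hΨ.hasDerivWithinAt_orbit hΨ' hz h3 (h5.2.trans_lt hb.2)
  -- the second difference `u` of the flow satisfies `u' = p u` and `u(0) = 0`
  have hconst := constant_of_has_deriv_right_zero (a := (0 : ℝ)) (b := T)
    (f := fun t => Real.exp (-p * t) *
      (Ψ t.toNNReal a + Ψ t.toNNReal c - 2 * Ψ t.toNNReal m))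
    (by
      have h1 := hΨ.continuous_orbit hΨ' (Ioo_subset_Icc_self ha)
      have h2 := hΨ.continuous_orbit hΨ' (Ioo_subset_Icc_self hcI)
      have h3 := hΨ.continuous_orbit hΨ' (Ioo_subset_Icc_self hmI)
      exact (by fun_prop : Continuous _).continuousOn)
    (by
      intro t ht
      have h1 := hder a le_rfl hac.le ha t ht.1 ht.2.le
      have h2 := hder c hac.le le_rfl hcI t ht.1 ht.2.le
      have h3 := hder m (by linarith) (by linarith) hmI t ht.1 ht.2.le
      have h4 : HasDerivWithinAt (fun t => Real.exp (-p * t)) (Real.exp (-p * t) * (-p))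
          (Ici t) t := by
        have := ((hasDerivAt_id t).const_mul (-p)).exp
        simpa using this.hasDerivWithinAt
      have h5 := h4.mul ((h1.add h2).sub (h3.const_mul 2))
      refine h5.congr_deriv ?_
      simp only [Pi.add_apply, Pi.sub_apply]
      ring)
    T ⟨T.2, le_rfl⟩
  simp only [Real.toNNReal_coe, Real.toNNReal_zero, hΨ.zero_apply hΨ' (Ioo_subset_Icc_self ha),
    hΨ.zero_apply hΨ' (Ioo_subset_Icc_self hcI),
    hΨ.zero_apply hΨ' (Ioo_subset_Icc_self hmI)] at hconst
  have hz : a + c - 2 * m = 0 := by rw [hm]; ring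
  rw [hz, mul_zero] at hconst
  have h0 := (mul_eq_zero.1 hconst).resolve_left (Real.exp_pos _).ne'
  have hstr := (hs T hT0).2 (Ioo_subset_Icc_self ha) (Ioo_subset_Icc_self hcI) hac.ne
    (show (0 : ℝ) < 1 / 2 by norm_num) (show (0 : ℝ) < 1 / 2 by norm_num) (by norm_num)
  simp only [smul_eq_mul] at hstr
  rw [show (1 / 2 : ℝ) * a + 1 / 2 * c = m by rw [hm]; ring] at hstr
  linarith

/-- A strictly concave distortion does not reach `1` before `1`. -/
theorem lt_one_of_strictConcaveOn {ψ : ConcaveDistortion} (hs : StrictConcaveOn ℝ (Icc 0 1) ψ)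
    {x : ℝ} (hx : x ∈ Ico (0 : ℝ) 1) : ψ x < 1 := by
  refine lt_of_le_of_ne (ψ.le_one ⟨hx.1, hx.2.le⟩) fun h => ?_
  have := hs.2 ⟨hx.1, hx.2.le⟩ (right_mem_Icc.2 zero_le_one) hx.2.ne
    (show (0 : ℝ) < 1 / 2 by norm_num) (show (0 : ℝ) < 1 / 2 by norm_num) (by norm_num)
  simp only [smul_eq_mul] at this
  rw [h, ψ.map_one] at this
  have h2 := ψ.le_one (x := 1 / 2 * x + 1 / 2 * 1) ⟨by linarith [hx.1], by linarith [hx.2]⟩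
  linarith

/-- If orbits do not reach `1` and `Ψ_t` is affine on an interval, then so is `Ψ_s` for all
`s ≤ t`, since `Ψ_t = Ψ_{t-s} ∘ Ψ_s` with strictly increasing concave factors; hence `G` is affine
there. -/
theorem strictConcaveOn_of_generator (hΨ : IsDistortionSemigroup Ψ) (hΨ' : IsNontrivialFamily Ψ)
    (hG : StrictConcaveOn ℝ (Ioo 0 1) (generator Ψ))
    (h1 : ∀ x ∈ Ioo (0 : ℝ) 1, ∀ t : ℝ≥0, Ψ t x < 1) {t : ℝ≥0} (ht : 0 < t) :
    StrictConcaveOn ℝ (Icc 0 1) (Ψ t) := by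
  by_contra hns
  obtain ⟨a, b, p, q, ha, hb, hab, hΨt⟩ := (Ψ t).concaveOn.exists_affine_of_not_strict hns
  set x := (2 * a + b) / 3 with hx
  set y := (a + 2 * b) / 3 with hy
  set z := (a + b) / 2 with hz
  have hxI : x ∈ Ioo (0 : ℝ) 1 := ⟨by linarith [ha.1], by linarith [hb.2]⟩
  have hyI : y ∈ Ioo (0 : ℝ) 1 := ⟨by linarith [ha.1], by linarith [hb.2]⟩
  have hzI : z ∈ Ioo (0 : ℝ) 1 := ⟨by linarith [ha.1], by linarith [hb.2]⟩
  have hzxy : (1 / 2 : ℝ) * x + 1 / 2 * y = z := by rw [hx, hy, hz]; ring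
  have haff : Ψ t z = 1 / 2 * Ψ t x + 1 / 2 * Ψ t y := by
    rw [hΨt x ⟨by linarith, by linarith⟩, hΨt y ⟨by linarith, by linarith⟩,
      hΨt z ⟨by linarith, by linarith⟩, ← hzxy]
    ring
  have hs : ∀ s ≤ t, Ψ s z = 1 / 2 * Ψ s x + 1 / 2 * Ψ s y := by
    intro s hst
    have hxs := (Ψ s).mapsTo (Ioo_subset_Icc_self hxI)
    have hys := (Ψ s).mapsTo (Ioo_subset_Icc_self hyI)
    have hzs := (Ψ s).mapsTo (Ioo_subset_Icc_self hzI)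
    have hge := (Ψ s).concaveOn.2 (Ioo_subset_Icc_self hxI) (Ioo_subset_Icc_self hyI)
      (show (0 : ℝ) ≤ 1 / 2 by norm_num) (show (0 : ℝ) ≤ 1 / 2 by norm_num) (by norm_num)
    simp only [smul_eq_mul] at hge
    rw [hzxy] at hge
    refine le_antisymm ?_ hge
    by_contra! hlt
    have hw : Ψ s x * (1 / 2) + Ψ s y * (1 / 2) ∈ Icc (0 : ℝ) 1 :=
      ⟨by linarith [hxs.1, hys.1], by linarith [hxs.2, hys.2]⟩
    have hcomp : ∀ u ∈ Ioo (0 : ℝ) 1, Ψ (t - s) (Ψ s u) = Ψ t u := fun u hu => by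
      rw [hΨ _ _ u (Ioo_subset_Icc_self hu), tsub_add_cancel_of_le hst]
    have h3 := (Ψ (t - s)).concaveOn.2 hxs hys
      (show (0 : ℝ) ≤ 1 / 2 by norm_num) (show (0 : ℝ) ≤ 1 / 2 by norm_num) (by norm_num)
    simp only [smul_eq_mul] at h3
    rw [hcomp x hxI, hcomp y hyI, ← haff] at h3
    have h4 : Ψ (t - s) (1 / 2 * Ψ s x + 1 / 2 * Ψ s y) ≤ Ψ t z := by
      rw [← hcomp z hzI]
      exact (Ψ _).mono (by linarith [hw.1]) hlt.le hzs.2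
    have h5 := (Ψ (t - s)).strict_of_lt_one (by linarith [hw.1]) hlt hzs.2
      (h4.trans_lt (h1 z hzI t))
    rw [hcomp z hzI] at h5
    linarith
  have hGz : generator Ψ z = 1 / 2 * generator Ψ x + 1 / 2 * generator Ψ y := by
    refine tendsto_nhds_unique (hΨ.tendsto_generator hΨ' hzI)
      ((((hΨ.tendsto_generator hΨ' hxI).const_mul (1 / 2)).add
        ((hΨ.tendsto_generator hΨ' hyI).const_mul (1 / 2))).congr' ?_)
    filter_upwards [nhdsWithin_le_nhds (Iic_mem_nhds ht)] with s hs'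
    rw [hs s hs', ← hzxy]
    ring
  have := hG.2 hxI hyI (by intro h; linarith) (show (0 : ℝ) < 1 / 2 by norm_num)
    (show (0 : ℝ) < 1 / 2 by norm_num) (by norm_num)
  simp only [smul_eq_mul] at this
  rw [hzxy, hGz] at this
  exact lt_irrefl _ this

theorem strictConcaveOn_iff (hΨ : IsDistortionSemigroup Ψ) (hΨ' : IsNontrivialFamily Ψ) :
    (∀ t : ℝ≥0, 0 < t → StrictConcaveOn ℝ (Icc 0 1) (Ψ t)) ↔
      StrictConcaveOn ℝ (Ioo 0 1) (generator Ψ) ∧ ∀ ε ∈ Ioo (0 : ℝ) 1,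
        ∫⁻ s in Ioo (1 - ε) 1, ENNReal.ofReal (1 / generator Ψ s) = ⊤ := by
  constructor
  · refine fun hs => ⟨hΨ.strictConcaveOn_generator hΨ' hs, fun ε hε => ?_⟩
    have hε' : 1 - ε ∈ Ioo (0 : ℝ) 1 := ⟨by linarith [hε.2], by linarith [hε.1]⟩
    rw [hΨ.lintegral_inv_generator_eq_top_iff hΨ' hε']
    intro t
    refine (hΨ.monotone_time (le_add_of_nonneg_right zero_le_one)
      (Ioo_subset_Icc_self hε')).trans_lt
      (lt_one_of_strictConcaveOn (hs (t + 1) (by positivity)) ⟨hε'.1.le, hε'.2⟩)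
  · rintro ⟨hG, hI⟩ t ht
    refine hΨ.strictConcaveOn_of_generator hΨ' hG (fun x hx => ?_) ht
    rw [← hΨ.lintegral_inv_generator_eq_top_iff hΨ' hx]
    simpa using hI (1 - x) ⟨by linarith [hx.2], by linarith [hx.1]⟩

end IsDistortionSemigroup

end Generator

/-! ### Distorted expectations as integrals over the real line -/

section Kernel

variable {Ω : Type*} [MeasurableSpace Ω]

/-- The integrand `1_{x ≥ 0} ψ(1) - ψ(P(X ≤ x))`, whose integral over `ℝ` is the distorted
expectation of `X`; it is linear in `ψ`, which need not be a distortion. -/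
noncomputable def distortionKernel (P : Measure Ω) (ψ : ℝ → ℝ) (X : Ω → ℝ) (x : ℝ) : ℝ :=
  (Ici (0 : ℝ)).indicator (fun _ => ψ 1) x - ψ (cdf (P.map X) x)

variable (P : Measure Ω)

theorem cdf_mem_Icc (X : Ω → ℝ) (x : ℝ) : cdf (P.map X) x ∈ Icc (0 : ℝ) 1 :=
  ⟨cdf_nonneg _ _, cdf_le_one _ _⟩

theorem cdf_map_eq [IsProbabilityMeasure P] {X : Ω → ℝ} (hX : Measurable X) (x : ℝ) :
    cdf (P.map X) x = P.real {ω | X ω ≤ x} := by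
  have := Measure.isProbabilityMeasure_map (μ := P) hX.aemeasurable
  rw [cdf_eq_real, map_measureReal_apply hX measurableSet_Iic]
  rfl

theorem distortedCdf_nonneg (Ψ : ConcaveDistortion) (X : Ω → ℝ) (x : ℝ) :
    0 ≤ distortedCdf P Ψ X x := Ψ.nonneg (cdf_mem_Icc P X x)

theorem distortedCdf_le_one (Ψ : ConcaveDistortion) (X : Ω → ℝ) (x : ℝ) :
    distortedCdf P Ψ X x ≤ 1 := Ψ.le_one (cdf_mem_Icc P X x)

theorem measurable_distortedCdf (Ψ : ConcaveDistortion) (X : Ω → ℝ) :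
    Measurable (distortedCdf P Ψ X) := (monotone_distortedCdf P Ψ X).measurable

theorem measurable_distortionKernel (Ψ : ConcaveDistortion) (X : Ω → ℝ) :
    Measurable (distortionKernel P Ψ X) :=
  (measurable_const.indicator measurableSet_Ici).sub (measurable_distortedCdf P Ψ X)

theorem distortionKernel_of_neg (Ψ : ConcaveDistortion) (X : Ω → ℝ) {x : ℝ} (hx : x < 0) :
    distortionKernel P Ψ X x = - distortedCdf P Ψ X x := by
  simp [distortionKernel, distortedCdf, hx]

theorem distortionKernel_of_nonneg (Ψ : ConcaveDistortion) (X : Ω → ℝ) {x : ℝ} (hx : 0 ≤ x) :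
    distortionKernel P Ψ X x = 1 - distortedCdf P Ψ X x := by
  simp [distortionKernel, distortedCdf, hx, Ψ.map_one]

theorem distortedCdf_le_stieltjes (Ψ : ConcaveDistortion) (X : Ω → ℝ) (x : ℝ) :
    distortedCdf P Ψ X x ≤ (monotone_distortedCdf P Ψ X).stieltjesFunction x := by
  rw [Monotone.stieltjesFunction_eq]
  exact (monotone_distortedCdf P Ψ X).le_rightLim le_rfl

theorem tendsto_stieltjes_atTop (Ψ : ConcaveDistortion) (X : Ω → ℝ) :
    Tendsto (monotone_distortedCdf P Ψ X).stieltjesFunction atTop (𝓝 1) := by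
  refine tendsto_of_tendsto_of_tendsto_of_le_of_le (tendsto_cdf_atTop (P.map X))
    tendsto_const_nhds (fun x => ?_) (fun x => ?_)
  · exact (Ψ.self_le (cdf_mem_Icc P X x)).trans (distortedCdf_le_stieltjes P Ψ X x)
  · rw [Monotone.stieltjesFunction_eq]
    exact ((monotone_distortedCdf P Ψ X).rightLim_le (lt_add_one x)).trans
      (distortedCdf_le_one P Ψ X _)

theorem tendsto_stieltjes_atBot (Ψ : ConcaveDistortion) (X : Ω → ℝ) :
    Tendsto (monotone_distortedCdf P Ψ X).stieltjesFunction atBot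
      (𝓝 (⨅ x : ℝ, distortedCdf P Ψ X x)) := by
  have h := tendsto_atBot_ciInf (monotone_distortedCdf P Ψ X)
    ⟨0, by rintro _ ⟨x, rfl⟩; exact distortedCdf_nonneg P Ψ X x⟩
  refine tendsto_of_tendsto_of_tendsto_of_le_of_le h
    (h.comp (tendsto_atBot_add_const_right _ (1 : ℝ) tendsto_id))
    (fun x => distortedCdf_le_stieltjes P Ψ X x) (fun x => ?_)
  rw [Monotone.stieltjesFunction_eq]
  exact (monotone_distortedCdf P Ψ X).rightLim_le (lt_add_one x)

/-- Passing to one-sided limits changes `Ψ(D_X)` at countably many points only. -/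
theorem ae_leftLim_eq_and_eq (Ψ : ConcaveDistortion) (X : Ω → ℝ) :
    ∀ᵐ x : ℝ,
      Function.leftLim (monotone_distortedCdf P Ψ X).stieltjesFunction x = distortedCdf P Ψ X x ∧
      (monotone_distortedCdf P Ψ X).stieltjesFunction x = distortedCdf P Ψ X x := by
  have hD := monotone_distortedCdf P Ψ X
  have h1 := hD.countable_not_continuousAt.ae_notMem volume
  have h2 := hD.stieltjesFunction.mono.countable_not_continuousAt.ae_notMem volume
  filter_upwards [h1, h2] with x hx1 hx2
  simp only [not_not] at hx1 hx2
  have e1 : hD.stieltjesFunction x = distortedCdf P Ψ X x := by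
    rw [Monotone.stieltjesFunction_eq]
    exact (hD.continuousWithinAt_Ioi_iff_rightLim_eq).1 hx1.continuousWithinAt
  refine ⟨?_, e1⟩
  rw [← e1]
  exact (hD.stieltjesFunction.mono.continuousWithinAt_Iio_iff_leftLim_eq).1 hx2.continuousWithinAt

theorem distortedPosPart_eq (Ψ : ConcaveDistortion) (X : Ω → ℝ) :
    distortedPosPart P Ψ X = ∫⁻ x in Ioi 0, ENNReal.ofReal (1 - distortedCdf P Ψ X x) := by
  have h1 : distortedPosPart P Ψ X = ∫⁻ x, ENNReal.ofReal (max x 0) ∂(distortedLaw P Ψ X) := by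
    refine lintegral_congr fun x => ?_
    rcases le_total x 0 with h | h
    · rw [max_eq_right h, ENNReal.ofReal_of_nonpos h, ENNReal.ofReal_zero]
    · rw [max_eq_left h]
  rw [h1, lintegral_eq_lintegral_meas_lt (f := fun x : ℝ => max x 0) _
    (ae_of_all _ fun x => le_max_right _ _) (by fun_prop)]
  refine lintegral_congr_ae ?_
  filter_upwards [ae_restrict_of_ae (ae_leftLim_eq_and_eq P Ψ X),
    ae_restrict_mem measurableSet_Ioi] with t ht ht0
  have : {a : ℝ | t < max a 0} = Ioi t := by
    ext a
    simp [not_lt.2 (le_of_lt (mem_Ioi.1 ht0))]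
  rw [this, distortedLaw, StieltjesFunction.measure_Ioi _ (tendsto_stieltjes_atTop P Ψ X), ht.2]

theorem distortedNegPart_eq (Ψ : ConcaveDistortion) (X : Ω → ℝ) :
    distortedNegPart P Ψ X = ∫⁻ x in Iio 0, ENNReal.ofReal (distortedCdf P Ψ X x) := by
  set l := ⨅ x : ℝ, distortedCdf P Ψ X x with hl
  have hl0 : 0 ≤ l := le_ciInf fun x => distortedCdf_nonneg P Ψ X x
  have hle : ∀ x, l ≤ distortedCdf P Ψ X x := fun x =>
    ciInf_le ⟨0, by rintro _ ⟨x, rfl⟩; exact distortedCdf_nonneg P Ψ X x⟩ x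
  have h1 : ∫⁻ x, ENNReal.ofReal (-x) ∂(distortedLaw P Ψ X) =
      ∫⁻ x, ENNReal.ofReal (max (-x) 0) ∂(distortedLaw P Ψ X) := by
    refine lintegral_congr fun x => ?_
    rcases le_total (-x) 0 with h | h
    · rw [max_eq_right h, ENNReal.ofReal_of_nonpos h, ENNReal.ofReal_zero]
    · rw [max_eq_left h]
  have hae : ∀ᵐ t : ℝ,
      Function.leftLim (monotone_distortedCdf P Ψ X).stieltjesFunction (-t) =
        distortedCdf P Ψ X (-t) := by
    have := (Measure.measurePreserving_neg (volume : Measure ℝ)).quasiMeasurePreserving.ae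
      (ae_leftLim_eq_and_eq P Ψ X)
    filter_upwards [this] with t ht using ht.1
  have h2 : ∫⁻ x, ENNReal.ofReal (max (-x) 0) ∂(distortedLaw P Ψ X) =
      ∫⁻ t in Ioi 0, ENNReal.ofReal (distortedCdf P Ψ X (-t) - l) := by
    rw [lintegral_eq_lintegral_meas_lt (f := fun x : ℝ => max (-x) 0) _
      (ae_of_all _ fun x => le_max_right _ _) (by fun_prop)]
    refine lintegral_congr_ae ?_
    filter_upwards [ae_restrict_of_ae hae, ae_restrict_mem measurableSet_Ioi] with t ht ht0
    have : {a : ℝ | t < max (-a) 0} = Iio (-t) := by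
      ext a
      simp only [mem_ofPred_eq, lt_max_iff, not_lt.2 (le_of_lt (mem_Ioi.1 ht0)), or_false, mem_Iio]
      constructor <;> intro h <;> linarith
    rw [this, distortedLaw, StieltjesFunction.measure_Iio _ (tendsto_stieltjes_atBot P Ψ X), ht]
  -- the mass `l` at `-∞` contributes the integral of the constant `l` over the half-line
  have h3 : ⊤ * ENNReal.ofReal l = ∫⁻ _ in Ioi (0 : ℝ), ENNReal.ofReal l := by
    rw [setLIntegral_const, Real.volume_Ioi, mul_comm]
  have h4 : ∫⁻ t in Ioi 0, ENNReal.ofReal (distortedCdf P Ψ X (-t)) =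
      ∫⁻ x in Iio 0, ENNReal.ofReal (distortedCdf P Ψ X x) := by
    have := (Measure.measurePreserving_neg (volume : Measure ℝ)).setLIntegral_comp_preimage
      (measurableSet_Iio (a := (0 : ℝ))) (measurable_distortedCdf P Ψ X).ennreal_ofReal
    simpa using this
  rw [distortedNegPart, ← hl, h1, h2, h3, ← lintegral_add_right _ measurable_const, ← h4]
  refine lintegral_congr fun t => ?_
  rw [← ENNReal.ofReal_add (sub_nonneg.2 (hle _)) hl0, sub_add_cancel]

theorem lintegral_ofReal_distortionKernel (Ψ : ConcaveDistortion) (X : Ω → ℝ) :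
    ∫⁻ x, ENNReal.ofReal (distortionKernel P Ψ X x) = distortedPosPart P Ψ X := by
  rw [distortedPosPart_eq, ← lintegral_indicator measurableSet_Ioi]
  refine lintegral_congr_ae ?_
  filter_upwards [compl_mem_ae_iff.2 (measure_singleton (0 : ℝ))] with x hx
  rcases lt_or_gt_of_ne hx with h | h
  · rw [indicator_of_notMem (by simpa using h.le), distortionKernel_of_neg P Ψ X h,
      ENNReal.ofReal_of_nonpos (neg_nonpos.2 (distortedCdf_nonneg P Ψ X x))]
  · rw [indicator_of_mem (by simpa using h), distortionKernel_of_nonneg P Ψ X h.le]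

theorem lintegral_ofReal_neg_distortionKernel (Ψ : ConcaveDistortion) (X : Ω → ℝ) :
    ∫⁻ x, ENNReal.ofReal (- distortionKernel P Ψ X x) = distortedNegPart P Ψ X := by
  rw [distortedNegPart_eq, ← lintegral_indicator measurableSet_Iio]
  refine lintegral_congr fun x => ?_
  rcases lt_or_ge x 0 with h | h
  · rw [indicator_of_mem (by simpa using h), distortionKernel_of_neg P Ψ X h, neg_neg]
  · rw [indicator_of_notMem (by simpa using h), distortionKernel_of_nonneg P Ψ X h,
      ENNReal.ofReal_of_nonpos (by linarith [distortedCdf_le_one P Ψ X x])]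

theorem integrable_distortionKernel_iff (Ψ : ConcaveDistortion) (X : Ω → ℝ) :
    Integrable (distortionKernel P Ψ X) ↔
      distortedPosPart P Ψ X ≠ ⊤ ∧ distortedNegPart P Ψ X ≠ ⊤ := by
  have h : ∫⁻ x, ‖distortionKernel P Ψ X x‖ₑ =
      distortedPosPart P Ψ X + distortedNegPart P Ψ X := by
    rw [← lintegral_ofReal_distortionKernel, ← lintegral_ofReal_neg_distortionKernel,
      ← lintegral_add_left (measurable_distortionKernel P Ψ X).ennreal_ofReal]
    refine lintegral_congr fun x => ?_
    rw [Real.enorm_eq_ofReal_abs]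
    rcases le_total 0 (distortionKernel P Ψ X x) with h | h
    · rw [abs_of_nonneg h, ENNReal.ofReal_of_nonpos (neg_nonpos.2 h), add_zero]
    · rw [abs_of_nonpos h, ENNReal.ofReal_of_nonpos h, zero_add]
  rw [Integrable, hasFiniteIntegral_iff_enorm, h, ENNReal.add_lt_top]
  simp only [(measurable_distortionKernel P Ψ X).aestronglyMeasurable, true_and, lt_top_iff_ne_top]

theorem distortedExpectation_eq_integral {Ψ : ConcaveDistortion} {X : Ω → ℝ}
    (h : Integrable (distortionKernel P Ψ X)) :
    distortedExpectation P Ψ X = ((∫ x, distortionKernel P Ψ X x : ℝ) : EReal) := by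
  obtain ⟨h1, h2⟩ := (integrable_distortionKernel_iff P Ψ X).1 h
  rw [integral_eq_lintegral_pos_part_sub_lintegral_neg_part h,
    lintegral_ofReal_distortionKernel, lintegral_ofReal_neg_distortionKernel, EReal.coe_sub,
    ← EReal.toReal_coe_ennreal, ← EReal.toReal_coe_ennreal,
    EReal.coe_toReal (by simpa using h1) (EReal.coe_ennreal_ne_bot _),
    EReal.coe_toReal (by simpa using h2) (EReal.coe_ennreal_ne_bot _)]
  rfl

theorem bot_lt_distortedExpectation_iff (Ψ : ConcaveDistortion) (X : Ω → ℝ) :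
    ⊥ < distortedExpectation P Ψ X ↔ distortedNegPart P Ψ X ≠ ⊤ := by
  rw [distortedExpectation]
  by_cases h : distortedNegPart P Ψ X = ⊤
  · simp [h]
  · rw [EReal.lt_sub_iff_add_lt (.inl (EReal.coe_ennreal_ne_bot _)) (.inl (by simpa using h))]
    simp [h]

/-- The right tail of `X` is dominated by the left tail of `-X`, since `Ψ(p) ≥ p`. -/
theorem distortedPosPart_le [IsProbabilityMeasure P] (Ψ : ConcaveDistortion) {X : Ω → ℝ}
    (hX : Measurable X) : distortedPosPart P Ψ X ≤ distortedNegPart P Ψ (-X) := by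
  rw [distortedPosPart_eq, distortedNegPart_eq]
  have h4 : ∫⁻ t in Ioi 0, ENNReal.ofReal (distortedCdf P Ψ (-X) (-t)) =
      ∫⁻ x in Iio 0, ENNReal.ofReal (distortedCdf P Ψ (-X) x) := by
    have := (Measure.measurePreserving_neg (volume : Measure ℝ)).setLIntegral_comp_preimage
      (measurableSet_Iio (a := (0 : ℝ))) (measurable_distortedCdf P Ψ (-X)).ennreal_ofReal
    simpa using this
  rw [← h4]
  refine lintegral_mono fun t => ENNReal.ofReal_le_ofReal ?_
  have h1 := Ψ.self_le (cdf_mem_Icc P X t)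
  have h2 := Ψ.self_le (cdf_mem_Icc P (-X) (-t))
  have h3 : 1 ≤ cdf (P.map X) t + cdf (P.map (-X)) (-t) := by
    rw [cdf_map_eq P hX, cdf_map_eq P hX.neg]
    have : {ω | X ω ≤ t} ∪ {ω | (-X) ω ≤ -t} = univ := by
      ext ω
      simpa using le_total (X ω) t
    calc (1 : ℝ) = P.real ({ω | X ω ≤ t} ∪ {ω | (-X) ω ≤ -t}) := by rw [this]; simp
      _ ≤ _ := measureReal_union_le _ _
  simp only [distortedCdf] at *
  linarith

theorem mem_indexL1_iff [IsProbabilityMeasure P] (Ψ : ℝ≥0 → ConcaveDistortion) (X : Ω → ℝ) :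
    X ∈ indexL1 P Ψ ↔ Measurable X ∧ ∀ t, Integrable (distortionKernel P (Ψ t) X) ∧
      Integrable (distortionKernel P (Ψ t) (-X)) := by
  simp only [indexL1, mem_ofPred_eq, bot_lt_distortedExpectation_iff,
    integrable_distortionKernel_iff]
  refine and_congr_right fun hX => forall_congr' fun t => ⟨fun h => ?_, fun h => ⟨h.1.2, h.2.2⟩⟩
  have h1 := distortedPosPart_le P (Ψ t) hX
  have h2 := distortedPosPart_le P (Ψ t) hX.neg
  rw [neg_neg] at h2
  exact ⟨⟨ne_top_of_le_ne_top h.2 h1, h.1⟩, ⟨ne_top_of_le_ne_top h.1 h2, h.2⟩⟩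

end Kernel

/-! ### The space of integrable random variables -/

section Space

variable {Ω : Type*} [MeasurableSpace Ω] (P : Measure Ω)

theorem distortedNegPart_ne_top_iff (Ψ : ConcaveDistortion) (X : Ω → ℝ) :
    distortedNegPart P Ψ X ≠ ⊤ ↔ IntegrableOn (distortedCdf P Ψ X) (Iio 0) := by
  rw [distortedNegPart_eq, IntegrableOn, Integrable, hasFiniteIntegral_iff_ofReal
    (ae_of_all _ fun x => distortedCdf_nonneg P Ψ X x), lt_top_iff_ne_top]
  simp only [(measurable_distortedCdf P Ψ X).aestronglyMeasurable, true_and]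

variable [IsProbabilityMeasure P]

/-- Distorted distribution functions satisfy a union bound, since concave distortions are
subadditive. -/
theorem distortedCdf_le_add (Ψ : ConcaveDistortion) {X Y Z : Ω → ℝ} (hX : Measurable X)
    (hY : Measurable Y) (hZ : Measurable Z) {x y z : ℝ}
    (h : ∀ ω, Z ω ≤ z → X ω ≤ x ∨ Y ω ≤ y) :
    distortedCdf P Ψ Z z ≤ distortedCdf P Ψ X x + distortedCdf P Ψ Y y := by
  have hF : cdf (P.map Z) z ≤ cdf (P.map X) x + cdf (P.map Y) y := by
    rw [cdf_map_eq P hX, cdf_map_eq P hY, cdf_map_eq P hZ]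
    exact (measureReal_mono (fun ω hω => h ω hω)).trans (measureReal_union_le _ _)
  have hx := cdf_mem_Icc P X x
  have hy := cdf_mem_Icc P Y y
  have hz := cdf_mem_Icc P Z z
  simp only [distortedCdf]
  rcases le_total (cdf (P.map X) x + cdf (P.map Y) y) 1 with h1 | h1
  · have := Ψ.add_le_add_of_between (i := 0) le_rfl hx.1 hy.1 h1 (by ring)
    rw [Ψ.map_zero, zero_add] at this
    exact (Ψ.mono hz.1 hF h1).trans this
  · linarith [Ψ.le_one hz, Ψ.self_le hx, Ψ.self_le hy]

theorem distortedNegPart_ne_top_of_bounded (Ψ : ConcaveDistortion) {X : Ω → ℝ}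
    (hX : Measurable X) {C : ℝ} (hC : ∀ ω, C < X ω) : distortedNegPart P Ψ X ≠ ⊤ := by
  rw [distortedNegPart_ne_top_iff]
  have h0 : ∀ x ≤ C, distortedCdf P Ψ X x = 0 := by
    intro x hx
    have : {ω | X ω ≤ x} = ∅ := by
      ext ω
      simpa using hx.trans_lt (hC ω)
    rw [distortedCdf, cdf_map_eq P hX, this, measureReal_empty, Ψ.map_zero]
  have h1 : IntegrableOn (distortedCdf P Ψ X) (Icc C 0) :=
    (monotone_distortedCdf P Ψ X).locallyIntegrable.integrableOn_isCompact isCompact_Icc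
  have h2 : IntegrableOn (distortedCdf P Ψ X) (Iic C) :=
    integrableOn_zero.congr_fun (fun x hx => (h0 x hx).symm) measurableSet_Iic
  refine (h2.union h1).mono_set fun x hx => ?_
  rcases le_total x C with h | h
  · exact Or.inl h
  · exact Or.inr ⟨h, le_of_lt hx⟩

theorem distortedNegPart_ne_top_of_le {Ψ : ConcaveDistortion} {X Z : Ω → ℝ} (hX : Measurable X)
    (hZ : Measurable Z) (hle : X ≤ Z) (h : distortedNegPart P Ψ X ≠ ⊤) :
    distortedNegPart P Ψ Z ≠ ⊤ := by
  rw [distortedNegPart_ne_top_iff] at h ⊢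
  refine h.mono' (measurable_distortedCdf P Ψ Z).aestronglyMeasurable (ae_of_all _ fun x => ?_)
  rw [Real.norm_of_nonneg (distortedCdf_nonneg P Ψ Z x)]
  refine Ψ.mono (cdf_nonneg _ _) ?_ (cdf_le_one _ _)
  rw [cdf_map_eq P hX, cdf_map_eq P hZ]
  exact measureReal_mono fun ω hω => (hle ω).trans hω

theorem distortedNegPart_min_ne_top {Ψ : ConcaveDistortion} {X Y : Ω → ℝ} (hX : Measurable X)
    (hY : Measurable Y) (h : distortedNegPart P Ψ X ≠ ⊤) (h' : distortedNegPart P Ψ Y ≠ ⊤) :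
    distortedNegPart P Ψ (fun ω => min (X ω) (Y ω)) ≠ ⊤ := by
  rw [distortedNegPart_ne_top_iff] at h h' ⊢
  refine (h.add h').mono' (measurable_distortedCdf P Ψ _).aestronglyMeasurable
    (ae_of_all _ fun x => ?_)
  rw [Real.norm_of_nonneg (distortedCdf_nonneg P Ψ _ x)]
  exact distortedCdf_le_add P Ψ hX hY (hX.min hY) fun ω hω => min_le_iff.1 hω

theorem distortedNegPart_add_ne_top {Ψ : ConcaveDistortion} {X Y : Ω → ℝ} (hX : Measurable X)
    (hY : Measurable Y) (h : distortedNegPart P Ψ X ≠ ⊤) (h' : distortedNegPart P Ψ Y ≠ ⊤) :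
    distortedNegPart P Ψ (X + Y) ≠ ⊤ := by
  have hdiv : ∀ Z : Ω → ℝ, distortedNegPart P Ψ Z ≠ ⊤ →
      IntegrableOn (fun x => distortedCdf P Ψ Z (x / 2)) (Iio 0) := by
    intro Z hZ
    rw [distortedNegPart_ne_top_iff, ← integrable_indicator_iff measurableSet_Iio] at hZ
    rw [← integrable_indicator_iff measurableSet_Iio]
    refine (hZ.comp_div two_ne_zero).congr (ae_of_all _ fun x => ?_)
    simp only [indicator, mem_Iio]
    congr 1
    simp only [eq_iff_iff]
    constructor <;> intro h <;> linarith
  rw [distortedNegPart_ne_top_iff]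
  refine ((hdiv X h).add (hdiv Y h')).mono' (measurable_distortedCdf P Ψ _).aestronglyMeasurable
    (ae_of_all _ fun x => ?_)
  rw [Real.norm_of_nonneg (distortedCdf_nonneg P Ψ _ x)]
  refine distortedCdf_le_add P Ψ hX hY (hX.add hY) fun ω hω => ?_
  by_contra! hcon
  have : X ω + Y ω ≤ x := hω
  linarith

end Space

section Space

variable {Ω : Type*} [MeasurableSpace Ω] {P : Measure Ω} {Ψ : ℝ≥0 → ConcaveDistortion}

theorem mem_indexL1_iff_negPart {X : Ω → ℝ} : X ∈ indexL1 P Ψ ↔ Measurable X ∧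
    ∀ t, distortedNegPart P (Ψ t) X ≠ ⊤ ∧ distortedNegPart P (Ψ t) (-X) ≠ ⊤ := by
  simp only [indexL1, mem_ofPred_eq, bot_lt_distortedExpectation_iff]

theorem indexL1_neg {X : Ω → ℝ} (hX : X ∈ indexL1 P Ψ) : -X ∈ indexL1 P Ψ := by
  rw [mem_indexL1_iff_negPart] at hX ⊢
  exact ⟨hX.1.neg, fun t => ⟨(hX.2 t).2, by simpa using (hX.2 t).1⟩⟩

variable [IsProbabilityMeasure P]

theorem indexL1_of_bounded {X : Ω → ℝ} (hX : Measurable X) {C : ℝ} (hC : ∀ ω, |X ω| < C) :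
    X ∈ indexL1 P Ψ :=
  mem_indexL1_iff_negPart.2 ⟨hX, fun _ =>
    ⟨distortedNegPart_ne_top_of_bounded P _ hX fun ω => (abs_lt.1 (hC ω)).1,
      distortedNegPart_ne_top_of_bounded P _ hX.neg fun ω => neg_lt_neg (abs_lt.1 (hC ω)).2⟩⟩

theorem indexL1_add {X Y : Ω → ℝ} (hX : X ∈ indexL1 P Ψ) (hY : Y ∈ indexL1 P Ψ) :
    X + Y ∈ indexL1 P Ψ := by
  rw [mem_indexL1_iff_negPart] at hX hY ⊢
  refine ⟨hX.1.add hY.1, fun t =>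
    ⟨distortedNegPart_add_ne_top P hX.1 hY.1 (hX.2 t).1 (hY.2 t).1, ?_⟩⟩
  rw [neg_add]
  exact distortedNegPart_add_ne_top P hX.1.neg hY.1.neg (hX.2 t).2 (hY.2 t).2

theorem indexL1_add_const {X : Ω → ℝ} (hX : X ∈ indexL1 P Ψ) (a : ℝ) :
    (fun ω => X ω + a) ∈ indexL1 P Ψ :=
  indexL1_add hX (Y := fun _ => a)
    (indexL1_of_bounded measurable_const (C := |a| + 1) fun _ => lt_add_one _)

theorem indexL1_min {X Y : Ω → ℝ} (hX : X ∈ indexL1 P Ψ) (hY : Y ∈ indexL1 P Ψ) :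
    (fun ω => min (X ω) (Y ω)) ∈ indexL1 P Ψ := by
  rw [mem_indexL1_iff_negPart] at hX hY ⊢
  refine ⟨hX.1.min hY.1, fun t =>
    ⟨distortedNegPart_min_ne_top P hX.1 hY.1 (hX.2 t).1 (hY.2 t).1, ?_⟩⟩
  exact distortedNegPart_ne_top_of_le P hX.1.neg (hX.1.min hY.1).neg
    (fun ω => neg_le_neg (min_le_left _ _)) (hX.2 t).2

theorem indexL1_max {X Y : Ω → ℝ} (hX : X ∈ indexL1 P Ψ) (hY : Y ∈ indexL1 P Ψ) :
    (fun ω => max (X ω) (Y ω)) ∈ indexL1 P Ψ := by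
  have := indexL1_neg (indexL1_min (indexL1_neg hX) (indexL1_neg hY))
  have e : (fun ω => max (X ω) (Y ω)) = -fun ω => min ((-X) ω) ((-Y) ω) := by
    ext ω
    simp only [Pi.neg_apply, min_neg_neg, neg_neg]
  rwa [e]

end Space

/-! ### Superadditivity of distorted expectations -/

section Superadditivity

variable {Ω : Type*} [MeasurableSpace Ω] (P : Measure Ω)

/-- `∫ (1_{x ≥ a} - 1_{x ≥ b}) dx = b - a`, in either order of `a` and `b`. -/
theorem integrable_indicator_Ici_sub (a b : ℝ) :
    Integrable (fun x : ℝ => (Ici a).indicator (fun _ => (1 : ℝ)) x -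
      (Ici b).indicator (fun _ => (1 : ℝ)) x) ∧
    ∫ x : ℝ, ((Ici a).indicator (fun _ => (1 : ℝ)) x - (Ici b).indicator (fun _ => (1 : ℝ)) x) =
      b - a := by
  have key : ∀ a b : ℝ, a ≤ b → (fun x : ℝ => (Ici a).indicator (fun _ => (1 : ℝ)) x -
      (Ici b).indicator (fun _ => (1 : ℝ)) x) = (Ico a b).indicator (fun _ => (1 : ℝ)) := by
    intro a b hab
    ext x
    simp only [indicator, mem_Ici, mem_Ico]
    split_ifs <;> grind
  have key2 : ∀ a b : ℝ, a ≤ b → Integrable ((Ico a b).indicator (fun _ => (1 : ℝ))) ∧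
      ∫ x : ℝ, (Ico a b).indicator (fun _ => (1 : ℝ)) x = b - a := by
    intro a b hab
    refine ⟨(integrable_indicator_iff measurableSet_Ico).2 (integrableOn_const (by simp)), ?_⟩
    rw [integral_indicator measurableSet_Ico]
    simp [hab]
  rcases le_total a b with h | h
  · rw [key a b h]
    exact key2 a b h
  · have e : (fun x : ℝ => (Ici a).indicator (fun _ => (1 : ℝ)) x -
      (Ici b).indicator (fun _ => (1 : ℝ)) x) = -(Ico b a).indicator (fun _ => (1 : ℝ)) := by
      rw [← key b a h]
      ext x
      simp
    rw [e]
    refine ⟨(key2 b a h).1.neg, ?_⟩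
    rw [integral_neg', (key2 b a h).2, neg_sub]

theorem integrableOn_cdf_Iio {X : Ω → ℝ} (h : Integrable (distortionKernel P id X)) (c : ℝ) :
    IntegrableOn (cdf (P.map X)) (Iio c) := by
  have h1 : IntegrableOn (cdf (P.map X)) (Iio 0) := by
    refine (h.integrableOn.neg).congr_fun (fun x hx => ?_) measurableSet_Iio
    simp [distortionKernel, not_le.2 (mem_Iio.1 hx)]
  have h2 : IntegrableOn (cdf (P.map X)) (Icc 0 c) :=
    (monotone_cdf _).locallyIntegrable.integrableOn_isCompact isCompact_Icc
  refine (h1.union h2).mono_set fun x hx => ?_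
  rcases lt_or_ge x 0 with h | h
  · exact Or.inl h
  · exact Or.inr ⟨h, le_of_lt hx⟩

theorem lintegral_sub_posPart [IsProbabilityMeasure P] {X : Ω → ℝ} (hX : Measurable X) (c : ℝ) :
    ∫⁻ ω, ENNReal.ofReal (max (c - X ω) 0) ∂P =
      ∫⁻ x in Iio c, ENNReal.ofReal (cdf (P.map X) x) := by
  rw [lintegral_eq_lintegral_meas_le (f := fun ω => max (c - X ω) 0) _
    (ae_of_all _ fun x => le_max_right _ _) (by fun_prop)]
  have h4 : ∫⁻ t in Ioi 0, ENNReal.ofReal (cdf (P.map X) (c - t)) =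
      ∫⁻ x in Iio c, ENNReal.ofReal (cdf (P.map X) x) := by
    have := (Measure.measurePreserving_sub_left (volume : Measure ℝ) c).setLIntegral_comp_preimage
      (measurableSet_Iio (a := c)) (monotone_cdf (P.map X)).measurable.ennreal_ofReal
    simpa using this
  rw [← h4]
  refine setLIntegral_congr_fun measurableSet_Ioi fun t ht => ?_
  rw [cdf_map_eq P hX, ofReal_measureReal]
  congr 1
  ext ω
  simp only [mem_ofPred_eq, le_max_iff, not_le.2 (mem_Ioi.1 ht), or_false]
  constructor <;> intro h <;> linarith

/-- The expected shortfall `E (c - X)⁺` is the integral of the distribution function up to `c`. -/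
theorem integral_sub_posPart [IsProbabilityMeasure P] {X : Ω → ℝ} (hX : Measurable X)
    (h : Integrable (distortionKernel P id X)) (c : ℝ) :
    Integrable (fun ω => max (c - X ω) 0) P ∧
      ∫ ω, max (c - X ω) 0 ∂P = ∫ x in Iio c, cdf (P.map X) x := by
  have h1 := integrableOn_cdf_Iio P h c
  have h2 := lintegral_sub_posPart P hX c
  have h0 : ∀ᵐ x ∂(volume.restrict (Iio c)), 0 ≤ cdf (P.map X) x :=
    ae_of_all _ fun x => cdf_nonneg _ _
  have h0' : ∀ᵐ ω ∂P, 0 ≤ max (c - X ω) 0 := ae_of_all _ fun x => le_max_right _ _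
  have hm : AEStronglyMeasurable (fun ω => max (c - X ω) 0) P :=
    (by fun_prop : Measurable fun ω => max (c - X ω) 0).aestronglyMeasurable
  refine ⟨⟨hm, ?_⟩, ?_⟩
  · rw [hasFiniteIntegral_iff_ofReal h0', h2, ← hasFiniteIntegral_iff_ofReal h0]
    exact h1.2
  · rw [integral_eq_lintegral_of_nonneg_ae h0' hm, h2, integral_eq_lintegral_of_nonneg_ae h0 h1.1]

theorem measurable_distortionKernel_min (l : ℝ) (X : Ω → ℝ) :
    Measurable (distortionKernel P (fun p => min p l) X) :=
  (measurable_const.indicator measurableSet_Ici).sub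
    ((monotone_cdf (P.map X)).measurable.min measurable_const)

theorem abs_distortionKernel_min_le {l : ℝ} (hl0 : 0 ≤ l) (hl1 : l ≤ 1) (X : Ω → ℝ) (x : ℝ) :
    |distortionKernel P (fun p => min p l) X x| ≤ |distortionKernel P id X x| := by
  have hF := cdf_mem_Icc P X x
  have h0 : 0 ≤ min (cdf (P.map X) x) l := le_min hF.1 hl0
  by_cases hx : 0 ≤ x
  · simp only [distortionKernel, indicator, mem_Ici, hx, if_true, id, min_eq_right hl1]
    rw [abs_of_nonneg (sub_nonneg.2 (min_le_right _ _)), abs_of_nonneg (by linarith [hF.2])]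
    rcases le_total (cdf (P.map X) x) l with h | h
    · rw [min_eq_left h]; linarith
    · rw [min_eq_right h]; linarith [hF.2]
  · simp only [distortionKernel, indicator, mem_Ici, hx, if_false, id, zero_sub, abs_neg]
    rw [abs_of_nonneg h0, abs_of_nonneg hF.1]
    exact min_le_left _ _

theorem integrable_distortionKernel_min {l : ℝ} (hl0 : 0 ≤ l) (hl1 : l ≤ 1) {X : Ω → ℝ}
    (h : Integrable (distortionKernel P id X)) :
    Integrable (distortionKernel P (fun p => min p l) X) :=
  h.mono (measurable_distortionKernel_min P l X).aestronglyMeasurable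
    (ae_of_all _ fun x => abs_distortionKernel_min_le P hl0 hl1 X x)

theorem integral_shortfall_kernel [IsProbabilityMeasure P] {X : Ω → ℝ} (hX : Measurable X)
    (h : Integrable (distortionKernel P id X)) (l c : ℝ) :
    Integrable (fun x => l * ((Ici (0 : ℝ)).indicator (fun _ => (1 : ℝ)) x -
      (Ici c).indicator (fun _ => (1 : ℝ)) x) - (Iio c).indicator (cdf (P.map X)) x) ∧
    ∫ x, (l * ((Ici (0 : ℝ)).indicator (fun _ => (1 : ℝ)) x -
      (Ici c).indicator (fun _ => (1 : ℝ)) x) - (Iio c).indicator (cdf (P.map X)) x) =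
      l * c - ∫ ω, max (c - X ω) 0 ∂P := by
  obtain ⟨h1, h2⟩ := integrable_indicator_Ici_sub 0 c
  have h3 := (integrable_indicator_iff measurableSet_Iio).2 (integrableOn_cdf_Iio P h c)
  refine ⟨(h1.const_mul l).sub h3, ?_⟩
  rw [integral_sub (h1.const_mul l) h3, integral_const_mul, h2,
    integral_indicator measurableSet_Iio, (integral_sub_posPart P hX h c).2, sub_zero]

/-- Each `c` gives a lower bound for the distorted expectation with `Ψ(p) = min p l`, because
`min (D_X(x)) l` is at most `D_X(x)` for `x < c` and at most `l` for `x ≥ c`. -/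
theorem le_integral_distortionKernel_min [IsProbabilityMeasure P] {l : ℝ} (hl0 : 0 ≤ l)
    (hl1 : l ≤ 1) {X : Ω → ℝ} (hX : Measurable X) (h : Integrable (distortionKernel P id X))
    (c : ℝ) : l * c - ∫ ω, max (c - X ω) 0 ∂P ≤
      ∫ x, distortionKernel P (fun p => min p l) X x := by
  obtain ⟨h1, h2⟩ := integral_shortfall_kernel P hX h l c
  rw [← h2]
  refine integral_mono h1 (integrable_distortionKernel_min P hl0 hl1 h) fun x => ?_
  have h3 := min_le_left (cdf (P.map X) x) l
  have h4 := min_le_right (cdf (P.map X) x) l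
  simp only [distortionKernel, indicator, mem_Ici, mem_Iio, min_eq_right hl1]
  by_cases hx : 0 ≤ x <;> by_cases hc : c ≤ x <;>
    simp only [hx, hc, not_lt.2, not_le.1, if_true, if_false, not_false_eq_true] <;> linarith

/-- The supremum over `c` of the previous lower bounds is attained at an `l`-quantile of `X`. -/
theorem exists_integral_distortionKernel_min_eq [IsProbabilityMeasure P] {l : ℝ} (hl0 : 0 < l)
    (hl1 : l < 1) {X : Ω → ℝ} (hX : Measurable X) (h : Integrable (distortionKernel P id X)) :
    ∃ c, ∫ x, distortionKernel P (fun p => min p l) X x =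
      l * c - ∫ ω, max (c - X ω) 0 ∂P := by
  set S := {x : ℝ | l ≤ cdf (P.map X) x}
  have hne : S.Nonempty := ((tendsto_cdf_atTop (P.map X)).eventually (le_mem_nhds hl1)).exists
  have hbd : BddBelow S := by
    obtain ⟨a, ha⟩ := ((tendsto_cdf_atBot (P.map X)).eventually (gt_mem_nhds hl0)).exists
    refine ⟨a, fun x hx => ?_⟩
    by_contra! hlt
    exact absurd (hx.trans (monotone_cdf _ hlt.le)) (not_le.2 ha)
  refine ⟨sInf S, ?_⟩
  rw [← (integral_shortfall_kernel P hX h l (sInf S)).2]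
  refine integral_congr_ae ?_
  filter_upwards [compl_mem_ae_iff.2 (measure_singleton (sInf S))] with x hx
  simp only [distortionKernel, min_eq_right hl1.le]
  rcases lt_or_gt_of_ne hx with hlt | hlt
  · have h1 : cdf (P.map X) x ≤ l := by
      by_contra! hcon
      exact absurd (csInf_le hbd (show x ∈ S from hcon.le)) (not_le.2 hlt)
    simp [indicator, hlt, not_le.2 hlt, min_eq_left h1]
  · have h1 : l ≤ cdf (P.map X) x := by
      obtain ⟨y, hy, hyx⟩ := exists_lt_of_csInf_lt hne hlt
      exact le_trans hy (monotone_cdf _ hyx.le)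
    simp only [indicator, mem_Ici, hlt.le, if_true, mem_Iio, not_lt.2 hlt.le, if_false,
      min_eq_right h1]
    split_ifs <;> ring

/-- Superadditivity for `Ψ(p) = min p l` follows from the variational formula and
`(c + d - X - Y)⁺ ≤ (c - X)⁺ + (d - Y)⁺`. -/
theorem superadditive_min_of_lt_one [IsProbabilityMeasure P] {l : ℝ} (hl0 : 0 < l) (hl1 : l < 1)
    {X Y : Ω → ℝ} (hX : Measurable X) (hY : Measurable Y)
    (hXi : Integrable (distortionKernel P id X)) (hYi : Integrable (distortionKernel P id Y))
    (hXYi : Integrable (distortionKernel P id (X + Y))) :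
    (∫ x, distortionKernel P (fun p => min p l) X x) +
        ∫ x, distortionKernel P (fun p => min p l) Y x ≤
      ∫ x, distortionKernel P (fun p => min p l) (X + Y) x := by
  obtain ⟨c, hc⟩ := exists_integral_distortionKernel_min_eq P hl0 hl1 hX hXi
  obtain ⟨d, hd⟩ := exists_integral_distortionKernel_min_eq P hl0 hl1 hY hYi
  refine le_trans ?_ (le_integral_distortionKernel_min P hl0.le hl1.le (hX.add hY) hXYi (c + d))
  have h1 := (integral_sub_posPart P hX hXi c).1
  have h2 := (integral_sub_posPart P hY hYi d).1
  have h3 := (integral_sub_posPart P (hX.add hY) hXYi (c + d)).1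
  have h4 : ∫ ω, max (c + d - (X + Y) ω) 0 ∂P ≤
      ∫ ω, max (c - X ω) 0 ∂P + ∫ ω, max (d - Y ω) 0 ∂P := by
    rw [← integral_add h1 h2]
    refine integral_mono h3 (h1.add h2) fun ω => ?_
    simp only [Pi.add_apply]
    refine max_le ?_ (add_nonneg (le_max_right _ _) (le_max_right _ _))
    have := le_max_left (c - X ω) 0
    have := le_max_left (d - Y ω) 0
    linarith
  rw [hc, hd]
  linarith

theorem superadditive_min [IsProbabilityMeasure P] {l : ℝ} (hl0 : 0 ≤ l) (hl1 : l ≤ 1)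
    {X Y : Ω → ℝ} (hX : Measurable X) (hY : Measurable Y)
    (hXi : Integrable (distortionKernel P id X)) (hYi : Integrable (distortionKernel P id Y))
    (hXYi : Integrable (distortionKernel P id (X + Y))) :
    (∫ x, distortionKernel P (fun p => min p l) X x) +
        ∫ x, distortionKernel P (fun p => min p l) Y x ≤
      ∫ x, distortionKernel P (fun p => min p l) (X + Y) x := by
  -- levels in `(0,1)` have quantiles; the levels `0` and `1` are limits of such
  obtain ⟨u, hu, hul⟩ : ∃ u : ℕ → ℝ, (∀ n, u n ∈ Ioo (0 : ℝ) 1) ∧ Tendsto u atTop (𝓝 l) := by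
    have : l ∈ closure (Ioo (0 : ℝ) 1) := by rw [closure_Ioo zero_ne_one]; exact ⟨hl0, hl1⟩
    exact mem_closure_iff_seq_limit.1 this
  have hlim : ∀ Z : Ω → ℝ, Integrable (distortionKernel P id Z) →
      Tendsto (fun n => ∫ x, distortionKernel P (fun p => min p (u n)) Z x) atTop
        (𝓝 (∫ x, distortionKernel P (fun p => min p l) Z x)) := by
    intro Z hZ
    refine tendsto_integral_of_dominated_convergence _
      (fun n => (measurable_distortionKernel_min P _ Z).aestronglyMeasurable) hZ.norm
      (fun n => ae_of_all _ fun x =>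
        abs_distortionKernel_min_le P (hu n).1.le (hu n).2.le Z x)
      (ae_of_all _ fun x => ?_)
    have hmin : ∀ p : ℝ, Tendsto (fun n => min p (u n)) atTop (𝓝 (min p l)) := fun p =>
      tendsto_const_nhds.min hul
    refine Tendsto.sub ?_ (hmin _)
    simp only [indicator]
    split_ifs
    · exact hmin 1
    · exact tendsto_const_nhds
  exact le_of_tendsto_of_tendsto' ((hlim X hXi).add (hlim Y hYi)) (hlim (X + Y) hXYi) fun n =>
    superadditive_min_of_lt_one P (hu n).1 (hu n).2 hX hY hXi hYi hXYi

/-- Summation by parts for nonnegative decreasing weights. -/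
theorem sum_mul_sub_nonneg {s D : ℕ → ℝ} {N : ℕ} (hs : ∀ k, k + 1 < N → s (k + 1) ≤ s k)
    (hs0 : ∀ k < N, 0 ≤ s k) (hD0 : D 0 = 0) (hD : ∀ k ≤ N, 0 ≤ D k) :
    0 ≤ ∑ k ∈ Finset.range N, s k * (D (k + 1) - D k) := by
  have key : ∀ n < N, s n * D n ≤ ∑ k ∈ Finset.range n, s k * (D (k + 1) - D k) := by
    intro n
    induction n with
    | zero => intro _; simp [hD0]
    | succ n ih =>
      intro hn
      rw [Finset.sum_range_succ]
      have h1 := ih (by omega)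
      have h2 := mul_le_mul_of_nonneg_right (hs n hn) (hD (n + 1) hn.le)
      linarith
  rcases N with _ | m
  · simp
  · rw [Finset.sum_range_succ]
    have h1 := key m (by omega)
    have h2 := mul_nonneg (hs0 m (by omega)) (hD (m + 1) le_rfl)
    linarith

namespace ConcaveDistortion

variable (Ψ : ConcaveDistortion)

/-- The slope of `Ψ` on the interval `[k/N, (k+1)/N]`. -/
noncomputable def gridSlope (N k : ℕ) : ℝ := N * (Ψ ((k + 1 : ℕ) / (N : ℝ)) - Ψ ((k : ℕ) / (N : ℝ)))

/-- The piecewise linear interpolation of `Ψ` at the points `k/N`, `0 ≤ k ≤ N`, written as a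
combination of the functions `p ↦ min p (k/N)`. -/
noncomputable def interpolation (N : ℕ) (p : ℝ) : ℝ :=
  ∑ k ∈ Finset.range N,
    Ψ.gridSlope N k * (min p ((k + 1 : ℕ) / (N : ℝ)) - min p ((k : ℕ) / (N : ℝ)))

theorem grid_mem {N k : ℕ} (hk : k ≤ N) : (k : ℝ) / N ∈ Icc (0 : ℝ) 1 :=
  ⟨by positivity, div_le_one_of_le₀ (by exact_mod_cast hk) (by positivity)⟩

theorem gridSlope_nonneg {N k : ℕ} (hk : k < N) : 0 ≤ Ψ.gridSlope N k := by
  refine mul_nonneg (by positivity) (sub_nonneg.2 (Ψ.mono (grid_mem hk.le).1 ?_ (grid_mem hk).2))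
  gcongr
  simp

theorem gridSlope_succ_le {N k : ℕ} (hk : k + 1 < N) :
    Ψ.gridSlope N (k + 1) ≤ Ψ.gridSlope N k := by
  have hN : (0 : ℝ) < N := by exact_mod_cast (by omega : 0 < N)
  have := Ψ.concaveOn.three_point (x := (k : ℕ) / (N : ℝ)) (y := (k + 1 : ℕ) / (N : ℝ))
    (z := (k + 1 + 1 : ℕ) / (N : ℝ)) (grid_mem (by omega)) (grid_mem (by omega))
    (by gcongr; simp) (by gcongr; simp)
  have e1 : ((k + 1 + 1 : ℕ) / (N : ℝ) - (k + 1 : ℕ) / (N : ℝ)) = 1 / N := by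
    push_cast; field_simp; ring
  have e2 : ((k + 1 : ℕ) / (N : ℝ) - (k : ℕ) / (N : ℝ)) = 1 / N := by
    push_cast; field_simp; ring
  have e3 : ((k + 1 + 1 : ℕ) / (N : ℝ) - (k : ℕ) / (N : ℝ)) = 2 * (1 / N) := by
    push_cast; field_simp; ring
  rw [e1, e2, e3] at this
  have hpos : (0 : ℝ) < 1 / N := by positivity
  have h2 : Ψ ((k : ℕ) / (N : ℝ)) + Ψ ((k + 1 + 1 : ℕ) / (N : ℝ)) ≤
      2 * Ψ ((k + 1 : ℕ) / (N : ℝ)) := by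
    refine le_of_mul_le_mul_left ?_ hpos
    linarith
  unfold gridSlope
  exact mul_le_mul_of_nonneg_left (by linarith) hN.le

theorem interpolation_le {N : ℕ} (hN : 0 < N) {p : ℝ} (hp : p ∈ Icc (0 : ℝ) 1) :
    Ψ.interpolation N p ≤ Ψ p := by
  have hN' : (0 : ℝ) < N := by exact_mod_cast hN
  have h : ∀ k ∈ Finset.range N,
      Ψ.gridSlope N k * (min p ((k + 1 : ℕ) / (N : ℝ)) - min p ((k : ℕ) / (N : ℝ))) ≤
      Ψ (min p ((k + 1 : ℕ) / (N : ℝ))) - Ψ (min p ((k : ℕ) / (N : ℝ))) := by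
    intro k hk
    have hk := Finset.mem_range.1 hk
    have hlt : (k : ℝ) / N ≤ (k + 1 : ℕ) / (N : ℝ) := by gcongr; simp
    rcases le_total p (k / N) with h1 | h1
    · rw [min_eq_left h1, min_eq_left (h1.trans hlt)]; simp
    rw [min_eq_right h1]
    set q := min p ((k + 1 : ℕ) / (N : ℝ)) with hq
    have h3 := Ψ.concaveOn.three_point (x := (k : ℕ) / (N : ℝ)) (y := q)
      (z := (k + 1 : ℕ) / (N : ℝ)) (grid_mem hk.le) (grid_mem hk) (le_min h1 hlt)
      (min_le_right _ _)
    have e2 : ((k + 1 : ℕ) / (N : ℝ) - (k : ℕ) / (N : ℝ)) = 1 / N := by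
      push_cast; field_simp; ring
    have e4 : ((k + 1 : ℕ) / (N : ℝ) - q) = 1 / N - (q - (k : ℕ) / (N : ℝ)) := by
      rw [← e2]; ring
    rw [e2, e4] at h3
    have h5 : (q - (k : ℕ) / (N : ℝ)) * (Ψ ((k + 1 : ℕ) / (N : ℝ)) - Ψ ((k : ℕ) / (N : ℝ))) ≤
      1 / N * (Ψ q - Ψ ((k : ℕ) / (N : ℝ))) := by linarith
    have h6 := mul_le_mul_of_nonneg_left h5 hN'.le
    rw [← mul_assoc (N : ℝ) (1 / N), mul_one_div_cancel hN'.ne', one_mul] at h6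
    unfold gridSlope
    linarith
  refine (Finset.sum_le_sum h).trans ?_
  rw [Finset.sum_range_sub (fun k : ℕ => Ψ (min p ((k : ℕ) / (N : ℝ)))) N]
  simp [div_self hN'.ne', min_eq_left hp.2, min_eq_right hp.1, Ψ.map_zero]

/-- The interpolation inherits `p ≤ Ψ(p)`, by summation by parts. -/
theorem le_interpolation {N : ℕ} (hN : 0 < N) {p : ℝ} (hp : p ∈ Icc (0 : ℝ) 1) :
    p ≤ Ψ.interpolation N p := by
  have hN' : (0 : ℝ) < N := by exact_mod_cast hN
  have h := sum_mul_sub_nonneg (s := Ψ.gridSlope N) (N := N)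
    (D := fun k => min p ((k : ℕ) / (N : ℝ)) - p * ((k : ℕ) / (N : ℝ)))
    (fun k hk => Ψ.gridSlope_succ_le hk) (fun k hk => Ψ.gridSlope_nonneg hk)
    (by simp [hp.1]) (fun k hk => sub_nonneg.2 (le_min
      (mul_le_of_le_one_right hp.1 (grid_mem hk).2)
      (mul_le_of_le_one_left (grid_mem hk).1 hp.2)))
  have e : ∑ k ∈ Finset.range N, Ψ.gridSlope N k *
      (min p ((k + 1 : ℕ) / (N : ℝ)) - p * ((k + 1 : ℕ) / (N : ℝ)) -
        (min p ((k : ℕ) / (N : ℝ)) - p * ((k : ℕ) / (N : ℝ)))) =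
      Ψ.interpolation N p - p * ∑ k ∈ Finset.range N,
        (Ψ ((k + 1 : ℕ) / (N : ℝ)) - Ψ ((k : ℕ) / (N : ℝ))) := by
    rw [interpolation, Finset.mul_sum, ← Finset.sum_sub_distrib]
    refine Finset.sum_congr rfl fun k _ => ?_
    have e2 : ((k + 1 : ℕ) / (N : ℝ)) = (k : ℕ) / (N : ℝ) + 1 / N := by
      push_cast; field_simp
    have e3 : Ψ.gridSlope N k * (1 / N) =
        Ψ ((k + 1 : ℕ) / (N : ℝ)) - Ψ ((k : ℕ) / (N : ℝ)) := by
      rw [gridSlope]; field_simp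
    rw [← e3, e2]
    ring
  rw [e, Finset.sum_range_sub (fun k : ℕ => Ψ ((k : ℕ) / (N : ℝ))) N] at h
  simp only [div_self hN'.ne', Ψ.map_one, Nat.cast_zero, zero_div, Ψ.map_zero] at h
  linarith

theorem interpolation_ge_grid {N j : ℕ} (hN : 0 < N) (hj : j ≤ N) {p : ℝ}
    (hp : (j : ℝ) / N ≤ p) : Ψ (j / N) ≤ Ψ.interpolation N p := by
  have hN' : (0 : ℝ) < N := by exact_mod_cast hN
  have h : ∀ k ∈ Finset.range N,
      Ψ (min ((j : ℝ) / N) ((k + 1 : ℕ) / (N : ℝ))) - Ψ (min ((j : ℝ) / N) ((k : ℕ) / (N : ℝ))) ≤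
      Ψ.gridSlope N k * (min p ((k + 1 : ℕ) / (N : ℝ)) - min p ((k : ℕ) / (N : ℝ))) := by
    intro k hk
    have hk := Finset.mem_range.1 hk
    have hlt : (k : ℝ) / N ≤ (k + 1 : ℕ) / (N : ℝ) := by gcongr; simp
    rcases Nat.lt_or_ge k j with h1 | h1
    · have h2 : ((k + 1 : ℕ) : ℝ) / N ≤ j / N := by
        gcongr
        exact_mod_cast h1
      rw [min_eq_right h2, min_eq_right (hlt.trans h2), min_eq_right (h2.trans hp),
        min_eq_right ((hlt.trans h2).trans hp)]
      have e2 : ((k + 1 : ℕ) / (N : ℝ)) - (k : ℕ) / (N : ℝ) = 1 / N := by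
        push_cast; field_simp; ring
      rw [e2, gridSlope]
      apply le_of_eq
      field_simp
    · have h2 : (j : ℝ) / N ≤ k / N := by gcongr
      rw [min_eq_left h2, min_eq_left (h2.trans hlt), sub_self]
      exact mul_nonneg (Ψ.gridSlope_nonneg hk) (sub_nonneg.2 (min_le_min_left _ hlt))
  refine le_trans ?_ (Finset.sum_le_sum h)
  rw [Finset.sum_range_sub (fun k : ℕ => Ψ (min ((j : ℝ) / N) ((k : ℕ) / (N : ℝ)))) N]
  have := grid_mem hj
  simp [div_self hN'.ne', min_eq_left this.2, min_eq_right this.1, Ψ.map_zero]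

theorem tendsto_interpolation {p : ℝ} (hp : p ∈ Icc (0 : ℝ) 1) :
    Tendsto (fun N : ℕ => Ψ.interpolation N p) atTop (𝓝 (Ψ p)) := by
  rcases eq_or_lt_of_le hp.1 with h0 | h0
  · subst h0
    rw [Ψ.map_zero]
    refine tendsto_const_nhds.congr fun N => ?_
    rw [interpolation]
    refine (Finset.sum_eq_zero fun k _ => ?_).symm
    rw [min_eq_left (by positivity), min_eq_left (by positivity), sub_self, mul_zero]
  have h1 : Tendsto (fun N : ℕ => (⌊p * N⌋₊ : ℝ) / N) atTop (𝓝 p) :=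
    (tendsto_nat_floor_mul_div_atTop h0.le).comp tendsto_natCast_atTop_atTop
  have hle : ∀ N : ℕ, (⌊p * N⌋₊ : ℝ) / N ≤ p := fun N =>
    div_le_of_le_mul₀ (by positivity) h0.le (Nat.floor_le (by positivity))
  have h2 : Tendsto (fun N : ℕ => (⌊p * N⌋₊ : ℝ) / N) atTop (𝓝[Ioc 0 1] p) := by
    refine tendsto_nhdsWithin_iff.2 ⟨h1, ?_⟩
    filter_upwards [h1.eventually (lt_mem_nhds h0)] with N hN using ⟨hN, (hle N).trans hp.2⟩
  have h3 := (Ψ.continuousOn_Ioc p ⟨h0, hp.2⟩).tendsto.comp h2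
  refine tendsto_of_tendsto_of_tendsto_of_le_of_le' h3 tendsto_const_nhds ?_ ?_
  · filter_upwards [eventually_gt_atTop 0] with N hN
    refine Ψ.interpolation_ge_grid hN ?_ (hle N)
    exact Nat.floor_le_of_le (mul_le_of_le_one_left (by positivity) hp.2)
  · filter_upwards [eventually_gt_atTop 0] with N hN using Ψ.interpolation_le hN hp

end ConcaveDistortion

theorem distortionKernel_interpolation (Ψ : ConcaveDistortion) (N : ℕ) (X : Ω → ℝ) :
    distortionKernel P (Ψ.interpolation N) X = fun x => ∑ k ∈ Finset.range N, Ψ.gridSlope N k *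
      (distortionKernel P (fun p => min p ((k + 1 : ℕ) / (N : ℝ))) X x -
        distortionKernel P (fun p => min p ((k : ℕ) / (N : ℝ))) X x) := by
  ext x
  simp only [distortionKernel, ConcaveDistortion.interpolation, indicator]
  split_ifs
  · rw [← Finset.sum_sub_distrib]
    exact Finset.sum_congr rfl fun k _ => by ring
  · rw [zero_sub, ← Finset.sum_neg_distrib]
    exact Finset.sum_congr rfl fun k _ => by ring

theorem integral_distortionKernel_interpolation (Ψ : ConcaveDistortion) (N : ℕ) {X : Ω → ℝ}
    (h : Integrable (distortionKernel P id X)) :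
    ∫ x, distortionKernel P (Ψ.interpolation N) X x = ∑ k ∈ Finset.range N, Ψ.gridSlope N k *
      ((∫ x, distortionKernel P (fun p => min p ((k + 1 : ℕ) / (N : ℝ))) X x) -
        ∫ x, distortionKernel P (fun p => min p ((k : ℕ) / (N : ℝ))) X x) := by
  have hi : ∀ k ≤ N, Integrable (distortionKernel P (fun p => min p ((k : ℕ) / (N : ℝ))) X) :=
    fun k hk => integrable_distortionKernel_min P (ConcaveDistortion.grid_mem hk).1
      (ConcaveDistortion.grid_mem hk).2 h
  rw [distortionKernel_interpolation, integral_finsetSum]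
  · refine Finset.sum_congr rfl fun k hk => ?_
    have hk := Finset.mem_range.1 hk
    rw [integral_const_mul, integral_sub (hi _ hk) (hi _ hk.le)]
  · intro k hk
    have hk := Finset.mem_range.1 hk
    exact ((hi _ hk).sub (hi _ hk.le)).const_mul _

theorem tendsto_integral_interpolation (Ψ : ConcaveDistortion) {X : Ω → ℝ}
    (hid : Integrable (distortionKernel P id X)) (h : Integrable (distortionKernel P Ψ X)) :
    Tendsto (fun N : ℕ => ∫ x, distortionKernel P (Ψ.interpolation N) X x) atTop
      (𝓝 (∫ x, distortionKernel P Ψ X x)) := by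
  refine tendsto_integral_filter_of_dominated_convergence
    (fun x => |distortionKernel P id X x| + |distortionKernel P Ψ X x|) ?_ ?_
    (hid.abs.add h.abs) ?_
  · refine Eventually.of_forall fun N => ?_
    rw [distortionKernel_interpolation]
    refine (Finset.measurable_fun_sum _ fun k _ => ?_).aestronglyMeasurable
    exact ((measurable_distortionKernel_min P _ X).sub
      (measurable_distortionKernel_min P _ X)).const_mul _
  · filter_upwards [eventually_gt_atTop 0] with N hN
    refine ae_of_all _ fun x => ?_
    have hF := cdf_mem_Icc P X x
    have h1 := Ψ.interpolation_le hN hF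
    have h2 := Ψ.le_interpolation hN hF
    have h3 : Ψ.interpolation N 1 = 1 :=
      le_antisymm ((Ψ.interpolation_le hN (by simp)).trans_eq Ψ.map_one)
        (Ψ.le_interpolation hN (by simp))
    have h4 := Ψ.le_one hF
    rw [Real.norm_eq_abs]
    by_cases hx : 0 ≤ x
    · refine le_trans ?_ (le_add_of_nonneg_right (abs_nonneg _))
      simp only [distortionKernel, indicator, mem_Ici, hx, if_true, id, h3]
      rw [abs_of_nonneg (by linarith), abs_of_nonneg (by linarith)]
      linarith
    · refine le_trans ?_ (le_add_of_nonneg_left (abs_nonneg _))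
      simp only [distortionKernel, indicator, mem_Ici, hx, if_false, zero_sub, abs_neg]
      rw [abs_of_nonneg (by linarith [hF.1]), abs_of_nonneg (by linarith [hF.1])]
      exact h1
  · refine ae_of_all _ fun x => Tendsto.sub ?_ (Ψ.tendsto_interpolation (cdf_mem_Icc P X x))
    simp only [indicator]
    split_ifs
    · exact Ψ.tendsto_interpolation (by simp)
    · exact tendsto_const_nhds

/-- Distorted expectations are superadditive. -/
theorem integral_distortionKernel_superadditive [IsProbabilityMeasure P] (Ψ : ConcaveDistortion)
    {X Y : Ω → ℝ} (hX : Measurable X) (hY : Measurable Y)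
    (hXi : Integrable (distortionKernel P id X)) (hYi : Integrable (distortionKernel P id Y))
    (hXYi : Integrable (distortionKernel P id (X + Y)))
    (hXΨ : Integrable (distortionKernel P Ψ X)) (hYΨ : Integrable (distortionKernel P Ψ Y))
    (hXYΨ : Integrable (distortionKernel P Ψ (X + Y))) :
    (∫ x, distortionKernel P Ψ X x) + ∫ x, distortionKernel P Ψ Y x ≤
      ∫ x, distortionKernel P Ψ (X + Y) x := by
  refine le_of_tendsto_of_tendsto' ((tendsto_integral_interpolation P Ψ hXi hXΨ).add
    (tendsto_integral_interpolation P Ψ hYi hYΨ))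
    (tendsto_integral_interpolation P Ψ hXYi hXYΨ) fun N => ?_
  rw [integral_distortionKernel_interpolation P Ψ N hXi,
    integral_distortionKernel_interpolation P Ψ N hYi,
    integral_distortionKernel_interpolation P Ψ N hXYi, ← sub_nonneg, ← Finset.sum_add_distrib,
    ← Finset.sum_sub_distrib]
  have h0 : ∀ Z : Ω → ℝ, ∫ x, distortionKernel P (fun p => min p ((0 : ℕ) / (N : ℝ))) Z x = 0 := by
    intro Z
    refine integral_eq_zero_of_ae (ae_of_all _ fun x => ?_)
    simp [distortionKernel, cdf_nonneg]
  have h := sum_mul_sub_nonneg (s := Ψ.gridSlope N) (N := N)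
    (D := fun k => (∫ x, distortionKernel P (fun p => min p ((k : ℕ) / (N : ℝ))) (X + Y) x) -
      ((∫ x, distortionKernel P (fun p => min p ((k : ℕ) / (N : ℝ))) X x) +
        ∫ x, distortionKernel P (fun p => min p ((k : ℕ) / (N : ℝ))) Y x))
    (fun k hk => Ψ.gridSlope_succ_le hk) (fun k hk => Ψ.gridSlope_nonneg hk)
    (by simp only [h0]; simp) (fun k hk => sub_nonneg.2 (superadditive_min P
      (ConcaveDistortion.grid_mem hk).1 (ConcaveDistortion.grid_mem hk).2 hX hY hXi hYi hXYi))
  refine h.trans_eq (Finset.sum_congr rfl fun k _ => ?_)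
  ring

end Superadditivity

/-! ### The acceptability index on the space of integrable random variables -/

section Index

variable {Ω : Type*} [MeasurableSpace Ω] {P : Measure Ω} {Ψ : ℝ≥0 → ConcaveDistortion}

theorem distortionKernel_zero (hΨ : IsDistortionSemigroup Ψ) (hΨ' : IsNontrivialFamily Ψ)
    (X : Ω → ℝ) : distortionKernel P (Ψ 0) X = distortionKernel P id X := by
  ext x
  simp only [distortionKernel, (Ψ 0).map_one, hΨ.zero_apply hΨ' (cdf_mem_Icc P X x), id]

theorem integral_distortionKernel_antitone (hΨ : IsDistortionSemigroup Ψ) {X : Ω → ℝ}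
    (hX : ∀ t, Integrable (distortionKernel P (Ψ t) X)) :
    Antitone fun t => ∫ x, distortionKernel P (Ψ t) X x := by
  intro s t hst
  refine integral_mono (hX t) (hX s) fun x => ?_
  have := hΨ.monotone_time hst (cdf_mem_Icc P X x)
  simp only [distortionKernel, (Ψ s).map_one, (Ψ t).map_one]
  linarith

theorem continuous_integral_distortionKernel (hΨ : IsDistortionSemigroup Ψ)
    (hΨ' : IsNontrivialFamily Ψ) {X : Ω → ℝ}
    (hX : ∀ t, Integrable (distortionKernel P (Ψ t) X)) :
    Continuous fun t => ∫ x, distortionKernel P (Ψ t) X x := by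
  refine continuous_iff_continuousAt.2 fun t => ?_
  refine continuousAt_of_dominated
    (bound := fun x => |distortionKernel P (Ψ 0) X x| + |distortionKernel P (Ψ (t + 1)) X x|)
    (Eventually.of_forall fun s => (hX s).1) ?_ ((hX 0).abs.add (hX (t + 1)).abs) ?_
  · filter_upwards [Iio_mem_nhds (lt_add_one t)] with s hs
    refine ae_of_all _ fun x => ?_
    have h1 := hΨ.monotone_time (zero_le (a := s)) (cdf_mem_Icc P X x)
    have h2 := hΨ.monotone_time (le_of_lt hs) (cdf_mem_Icc P X x)
    simp only [distortionKernel, (Ψ _).map_one]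
    rw [Real.norm_eq_abs]
    refine (abs_le_max_abs_abs (sub_le_sub_left h2 _) (sub_le_sub_left h1 _)).trans ?_
    exact max_le (le_add_of_nonneg_left (abs_nonneg _)) (le_add_of_nonneg_right (abs_nonneg _))
  · refine ae_of_all _ fun x => ?_
    simp only [distortionKernel, (Ψ _).map_one]
    exact (continuous_const.sub (hΨ.continuous_time hΨ' (cdf_mem_Icc P X x))).continuousAt

theorem distortedExpectation_nonneg_iff {ψ : ConcaveDistortion} {X : Ω → ℝ}
    (hX : Integrable (distortionKernel P ψ X)) :
    0 ≤ distortedExpectation P ψ X ↔ 0 ≤ ∫ x, distortionKernel P ψ X x := by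
  rw [distortedExpectation_eq_integral P hX]
  exact EReal.coe_nonneg

theorem le_acceptabilityIndex {X : Ω → ℝ} {t : ℝ≥0}
    (hX : Integrable (distortionKernel P (Ψ t) X)) (h : 0 ≤ ∫ x, distortionKernel P (Ψ t) X x) :
    (t : ℝ≥0∞) ≤ acceptabilityIndex P Ψ X :=
  le_iSup₂_of_le t ((distortedExpectation_nonneg_iff hX).2 h) le_rfl

theorem acceptabilityIndex_le {X : Ω → ℝ} {t : ℝ≥0}
    (hX : ∀ s, Integrable (distortionKernel P (Ψ s) X))
    (h : ∀ s, t < s → ∫ x, distortionKernel P (Ψ s) X x < 0) :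
    acceptabilityIndex P Ψ X ≤ t := by
  refine iSup₂_le fun s hs => ?_
  rw [distortedExpectation_nonneg_iff (hX s)] at hs
  by_contra! hlt
  exact absurd hs (not_le.2 (h s (by exact_mod_cast hlt)))

/-- By continuity in time, the supremum in a positive finite index is attained. -/
theorem integral_nonneg_of_acceptabilityIndex_eq (hΨ : IsDistortionSemigroup Ψ)
    (hΨ' : IsNontrivialFamily Ψ) {X : Ω → ℝ}
    (hX : ∀ s, Integrable (distortionKernel P (Ψ s) X)) {t : ℝ≥0} (ht : 0 < t)
    (h : acceptabilityIndex P Ψ X = t) : 0 ≤ ∫ x, distortionKernel P (Ψ t) X x := by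
  have hlt : ∀ s < t, 0 ≤ ∫ x, distortionKernel P (Ψ s) X x := by
    intro s hs
    have hs' : (s : ℝ≥0∞) < acceptabilityIndex P Ψ X := by rw [h]; exact_mod_cast hs
    obtain ⟨r, hr⟩ := lt_iSup_iff.1 hs'
    obtain ⟨hr0, hsr⟩ := lt_iSup_iff.1 hr
    rw [distortedExpectation_nonneg_iff (hX r)] at hr0
    exact hr0.trans
      (integral_distortionKernel_antitone hΨ hX (le_of_lt (by exact_mod_cast hsr)))
  have hne : (𝓝[<] t).NeBot := nhdsLT_neBot_of_exists_lt ⟨0, ht⟩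
  refine ge_of_tendsto (((continuous_integral_distortionKernel hΨ hΨ' hX).tendsto t).mono_left
    (nhdsWithin_le_nhds (s := Iio t))) ?_
  filter_upwards [self_mem_nhdsWithin] with s hs using hlt s hs

theorem lt_acceptabilityIndex (hΨ : IsDistortionSemigroup Ψ)
    (hΨ' : IsNontrivialFamily Ψ) {X : Ω → ℝ}
    (hX : ∀ s, Integrable (distortionKernel P (Ψ s) X)) {t : ℝ≥0}
    (h : 0 < ∫ x, distortionKernel P (Ψ t) X x) : (t : ℝ≥0∞) < acceptabilityIndex P Ψ X := by
  have h1 : ∀ᶠ s in 𝓝[>] t, 0 < ∫ x, distortionKernel P (Ψ s) X x := nhdsWithin_le_nhds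
    (((continuous_integral_distortionKernel hΨ hΨ' hX).tendsto t).eventually (lt_mem_nhds h))
  have hne : (𝓝[>] t).NeBot := nhdsGT_neBot_of_exists_gt ⟨t + 1, lt_add_one t⟩
  obtain ⟨s, hs, hts⟩ := (h1.and self_mem_nhdsWithin).exists
  exact lt_of_lt_of_le (by exact_mod_cast hts) (le_acceptabilityIndex (hX s) (le_of_lt hs))

end Index

/-! ### Comonotonicity -/

section Comonotone

/-- If `X` and `Y` are nowhere ordered oppositely on `S`, then on `S` the variable `X` is an
increasing function of `X + Y`: it depends on `X + Y` monotonically and in a `1`-Lipschitz way,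
and an infimal convolution extends this dependence to the line. -/
theorem exists_monotone_of_sum {Ω : Type*} {S : Set Ω} (hS : S.Nonempty) {X Y : Ω → ℝ}
    (h : ∀ ω ∈ S, ∀ ω' ∈ S, X ω < X ω' → Y ω ≤ Y ω') :
    ∃ f : ℝ → ℝ, Monotone f ∧ ∀ ω ∈ S, X ω = f (X ω + Y ω) := by
  have : Nonempty S := hS.to_subtype
  obtain ⟨ω₀, h₀⟩ := hS
  have key : ∀ ω ∈ S, ∀ ω' ∈ S, X ω' ≤ X ω + max (X ω' + Y ω' - (X ω + Y ω)) 0 := by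
    intro ω hω ω' hω'
    rcases le_or_gt (X ω') (X ω) with h1 | h1
    · linarith [le_max_right (X ω' + Y ω' - (X ω + Y ω)) 0]
    · linarith [le_max_left (X ω' + Y ω' - (X ω + Y ω)) 0, h ω hω ω' hω' h1]
  have hbd : ∀ z : ℝ, BddBelow (range fun ω : S => X ω + max (z - (X ω + Y ω)) 0) := by
    intro z
    refine ⟨X ω₀ - max (X ω₀ + Y ω₀ - z) 0, ?_⟩
    rintro _ ⟨⟨ω, hω⟩, rfl⟩
    have h1 := key ω hω ω₀ h₀
    have h2 : max (X ω₀ + Y ω₀ - (X ω + Y ω)) 0 ≤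
        max (X ω₀ + Y ω₀ - z) 0 + max (z - (X ω + Y ω)) 0 := by
      refine max_le ?_ (add_nonneg (le_max_right _ _) (le_max_right _ _))
      linarith [le_max_left (X ω₀ + Y ω₀ - z) 0, le_max_left (z - (X ω + Y ω)) 0]
    simp only
    linarith
  refine ⟨fun z => ⨅ ω : S, (X ω + max (z - (X ω + Y ω)) 0), fun y z hyz => ?_, fun ω hω => ?_⟩
  · exact ciInf_mono (hbd y) fun ω => by gcongr
  · refine le_antisymm (le_ciInf fun ω' => key _ ω'.2 _ hω) ?_
    refine (ciInf_le (hbd _) ⟨ω, hω⟩).trans_eq ?_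
    simp

variable {Ω : Type*} [MeasurableSpace Ω] {P : Measure Ω}

theorem comonotone_of_not_crossing [IsProbabilityMeasure P] {X Y : Ω → ℝ} (hX : Measurable X)
    (hY : Measurable Y) {S : Set Ω} (hS : ∀ᵐ ω ∂P, ω ∈ S)
    (h : ∀ ω ∈ S, ∀ ω' ∈ S, X ω < X ω' → Y ω ≤ Y ω') : Comonotone P X Y := by
  have hne : S.Nonempty := hS.exists
  obtain ⟨f, hf, hf'⟩ := exists_monotone_of_sum hne h
  obtain ⟨g, hg, hg'⟩ := exists_monotone_of_sum (X := Y) (Y := X) hne (by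
    intro ω hω ω' hω' h1
    by_contra! h2
    exact absurd (h ω' hω' ω hω h2) (not_le.2 h1))
  refine ⟨X + Y, f, g, hX.add hY, hf, hg, ?_, ?_⟩
  · filter_upwards [hS] with ω hω using hf' ω hω
  · filter_upwards [hS] with ω hω
    rw [hg' ω hω, add_comm]
    rfl

/-- Random variables that are not comonotone are oppositely ordered, with positive probability
each way, around some levels `a` and `b`. -/
theorem exists_crossing_of_not_comonotone [IsProbabilityMeasure P] {X Y : Ω → ℝ}
    (hX : Measurable X) (hY : Measurable Y) (h : ¬ Comonotone P X Y) :
    ∃ a b : ℝ, 0 < P {ω | X ω ≤ a ∧ b < Y ω} ∧ 0 < P {ω | a < X ω ∧ Y ω ≤ b} := by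
  by_contra! hcon
  refine h (comonotone_of_not_crossing hX hY (S := {ω | ∀ a b : ℚ,
    (P {ω | X ω ≤ a ∧ b < Y ω} = 0 → ¬ (X ω ≤ a ∧ b < Y ω)) ∧
    (P {ω | a < X ω ∧ Y ω ≤ b} = 0 → ¬ (a < X ω ∧ Y ω ≤ b))}) ?_ ?_)
  · refine ae_all_iff.2 fun a => ae_all_iff.2 fun b => ?_
    have aux : ∀ p : Ω → Prop, ∀ᵐ ω ∂P, P {ω | p ω} = 0 → ¬ p ω := by
      intro p
      by_cases h0 : P {ω | p ω} = 0
      · filter_upwards [compl_mem_ae_iff.2 h0] with ω hω _ using hω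
      · exact ae_of_all _ fun ω h1 => absurd h1 h0
    filter_upwards [aux fun ω => X ω ≤ a ∧ b < Y ω, aux fun ω => a < X ω ∧ Y ω ≤ b] with ω h1 h2
    exact ⟨h1, h2⟩
  · intro ω hω ω' hω' hlt
    by_contra! hlt'
    obtain ⟨a, ha1, ha2⟩ := exists_rat_btwn hlt
    obtain ⟨b, hb1, hb2⟩ := exists_rat_btwn hlt'
    rcases eq_or_ne (P {ω | X ω ≤ a ∧ b < Y ω}) 0 with h0 | h0
    · exact (hω a b).1 h0 ⟨ha1.le, hb2⟩
    · exact (hω' a b).2 (le_antisymm (hcon a b (pos_iff_ne_zero.2 h0)) zero_le) ⟨ha2, hb1.le⟩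

end Comonotone

/-! ### Strict superadditivity -/

section Strict

variable {Ω : Type*} [MeasurableSpace Ω] {P : Measure Ω}

theorem exists_pos_measure_lt_add {X Y : Ω → ℝ} {a b : ℝ} (h : 0 < P {ω | X ω ≤ a ∧ b < Y ω}) :
    ∃ n : ℕ, 0 < P {ω | X ω ≤ a ∧ b + 1 / (n + 1) < Y ω} := by
  by_contra! hcon
  refine h.ne' (measure_mono_null ?_
    (measure_iUnion_null fun n => le_antisymm (hcon n) zero_le))
  rintro ω ⟨h1, h2⟩
  obtain ⟨n, hn⟩ := exists_nat_one_div_lt (sub_pos.2 h2)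
  exact mem_iUnion.2 ⟨n, h1, by linarith⟩

variable [IsProbabilityMeasure P]

/-- Replacing `X, Y` by their maximum and minimum strictly increases the sum of the distorted
expectations if `Ψ` is strictly concave and `X, Y` are oppositely ordered around the level `0`.
Indeed the events `X ≤ x` and `Y ≤ x` are replaced by their intersection and their union. -/
theorem integral_distortionKernel_lt_max_min {ψ : ConcaveDistortion}
    (hψ : StrictConcaveOn ℝ (Icc 0 1) ψ) {X Y : Ω → ℝ} (hX : Measurable X) (hY : Measurable Y)
    (hXi : Integrable (distortionKernel P ψ X)) (hYi : Integrable (distortionKernel P ψ Y))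
    (hMi : Integrable (distortionKernel P ψ fun ω => max (X ω) (Y ω)))
    (hmi : Integrable (distortionKernel P ψ fun ω => min (X ω) (Y ω)))
    (h1 : 0 < P {ω | X ω ≤ 0 ∧ 0 < Y ω}) (h2 : 0 < P {ω | 0 < X ω ∧ Y ω ≤ 0}) :
    (∫ x, distortionKernel P ψ X x) + ∫ x, distortionKernel P ψ Y x <
      (∫ x, distortionKernel P ψ (fun ω => max (X ω) (Y ω)) x) +
        ∫ x, distortionKernel P ψ (fun ω => min (X ω) (Y ω)) x := by
  have hA : ∀ x, MeasurableSet {ω | X ω ≤ x} := fun x => hX measurableSet_Iic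
  have hB : ∀ x, MeasurableSet {ω | Y ω ≤ x} := fun x => hY measurableSet_Iic
  have hM : ∀ x, cdf (P.map fun ω => max (X ω) (Y ω)) x =
      P.real ({ω | X ω ≤ x} ∩ {ω | Y ω ≤ x}) := by
    intro x
    rw [cdf_map_eq P (hX.max hY)]
    congr 1
    ext ω
    simp
  have hm : ∀ x, cdf (P.map fun ω => min (X ω) (Y ω)) x =
      P.real ({ω | X ω ≤ x} ∪ {ω | Y ω ≤ x}) := by
    intro x
    rw [cdf_map_eq P (hX.min hY)]
    congr 1
    ext ω
    simp
  have hsum : ∀ x, P.real ({ω | X ω ≤ x} ∩ {ω | Y ω ≤ x}) +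
      P.real ({ω | X ω ≤ x} ∪ {ω | Y ω ≤ x}) = P.real {ω | X ω ≤ x} + P.real {ω | Y ω ≤ x} := by
    intro x
    rw [add_comm, measureReal_union_add_inter (hB x)]
  let d : ℝ → ℝ := fun x => (distortionKernel P ψ (fun ω => max (X ω) (Y ω)) x +
    distortionKernel P ψ (fun ω => min (X ω) (Y ω)) x) -
    (distortionKernel P ψ X x + distortionKernel P ψ Y x)
  have hd : ∀ x, d x = (ψ (P.real {ω | X ω ≤ x}) + ψ (P.real {ω | Y ω ≤ x})) -
      (ψ (P.real ({ω | X ω ≤ x} ∩ {ω | Y ω ≤ x})) +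
        ψ (P.real ({ω | X ω ≤ x} ∪ {ω | Y ω ≤ x}))) := by
    intro x
    simp only [d, distortionKernel, hM, hm, cdf_map_eq P hX, cdf_map_eq P hY]
    ring
  have hd0 : 0 ≤ d := by
    intro x
    rw [hd, Pi.zero_apply, sub_nonneg]
    exact ψ.add_le_add_of_between measureReal_nonneg (measureReal_mono inter_subset_left)
      (measureReal_mono inter_subset_right) measureReal_le_one (hsum x)
  have hdi : Integrable d := (hMi.add hmi).sub (hXi.add hYi)
  obtain ⟨n, hn⟩ := exists_pos_measure_lt_add h1
  obtain ⟨k, hk⟩ := exists_pos_measure_lt_add (X := Y) (Y := X) (a := 0) (b := 0)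
    (by simpa only [and_comm] using h2)
  set δ : ℝ := min (1 / (n + 1)) (1 / (k + 1))
  have hδ0 : 0 < δ := lt_min Nat.one_div_pos_of_nat Nat.one_div_pos_of_nat
  have hpos : ∀ x ∈ Ioo 0 δ, 0 < d x := by
    intro x hx
    have hlt : ∀ s t : Set Ω, MeasurableSet t → 0 < P (s \ t) → P.real (s ∩ t) < P.real s := by
      intro s t ht h0
      rw [← measureReal_inter_add_sdiff (s := s) ht]
      exact lt_add_of_pos_right _ (ENNReal.toReal_pos h0.ne' (measure_ne_top _ _))
    have h3 := hlt {ω | X ω ≤ x} {ω | Y ω ≤ x} (hB x) (hn.trans_le (measure_mono fun ω hω =>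
      ⟨hω.1.trans hx.1.le, fun (h : Y ω ≤ x) => by
        have := hω.2
        have : δ ≤ 1 / ((n : ℝ) + 1) := min_le_left _ _
        linarith [hx.2]⟩))
    have h4 := hlt {ω | Y ω ≤ x} {ω | X ω ≤ x} (hA x) (hk.trans_le (measure_mono fun ω hω =>
      ⟨hω.1.trans hx.1.le, fun (h : X ω ≤ x) => by
        have := hω.2
        have : δ ≤ 1 / ((k : ℝ) + 1) := min_le_right _ _
        linarith [hx.2]⟩))
    rw [inter_comm] at h4
    rw [hd, sub_pos]
    exact ψ.add_lt_add_of_between hψ measureReal_nonneg h3 h4 measureReal_le_one (hsum x)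
  have hint : 0 < ∫ x, d x := by
    rw [integral_pos_iff_support_of_nonneg hd0 hdi]
    have : (0 : ℝ≥0∞) < volume (Ioo 0 δ) := by simpa using hδ0
    exact this.trans_le (measure_mono fun x hx => (hpos x hx).ne')
  have he : ∫ x, d x = ((∫ x, distortionKernel P ψ (fun ω => max (X ω) (Y ω)) x) +
      ∫ x, distortionKernel P ψ (fun ω => min (X ω) (Y ω)) x) -
      ((∫ x, distortionKernel P ψ X x) + ∫ x, distortionKernel P ψ Y x) := by
    rw [← integral_add hMi hmi, ← integral_add hXi hYi]
    exact integral_sub (hMi.add hmi) (hXi.add hYi)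
  linarith

theorem integral_distortionKernel_add_const {ψ : ConcaveDistortion} {X : Ω → ℝ}
    (hX : Measurable X) (hXi : Integrable (distortionKernel P ψ X)) (a : ℝ) :
    ∫ x, distortionKernel P ψ (fun ω => X ω + a) x = (∫ x, distortionKernel P ψ X x) + a := by
  obtain ⟨h1, h2⟩ := integrable_indicator_Ici_sub 0 a
  have e : distortionKernel P ψ (fun ω => X ω + a) = fun x =>
      distortionKernel P ψ X (x - a) + ((Ici (0 : ℝ)).indicator (fun _ => (1 : ℝ)) x -
        (Ici a).indicator (fun _ => (1 : ℝ)) x) := by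
    ext x
    have h3 : cdf (P.map fun ω => X ω + a) x = cdf (P.map X) (x - a) := by
      rw [cdf_map_eq P hX, cdf_map_eq P (hX.add_const a)]
      simp only [le_sub_iff_add_le]
    simp only [distortionKernel, h3, ψ.map_one, indicator, mem_Ici, sub_nonneg]
    ring
  rw [e, integral_add (hXi.comp_sub_right a) h1, h2, sub_zero,
    integral_sub_right_eq_self (fun x => distortionKernel P ψ X x)]

/-- For a strictly concave distortion in the semigroup the distorted expectation is strictly
superadditive on pairs that are not comonotone. -/
theorem integral_distortionKernel_strict_superadditive {Ψ : ℝ≥0 → ConcaveDistortion}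
    (hΨ : IsDistortionSemigroup Ψ) (hΨ' : IsNontrivialFamily Ψ) {t : ℝ≥0}
    (hψ : StrictConcaveOn ℝ (Icc 0 1) (Ψ t)) {X Y : Ω → ℝ} (hX : X ∈ indexL1 P Ψ)
    (hY : Y ∈ indexL1 P Ψ) (hXY : ¬ Comonotone P X Y) :
    (∫ x, distortionKernel P (Ψ t) X x) + ∫ x, distortionKernel P (Ψ t) Y x <
      ∫ x, distortionKernel P (Ψ t) (X + Y) x := by
  have hint : ∀ {Z : Ω → ℝ}, Z ∈ indexL1 P Ψ → ∀ t, Integrable (distortionKernel P (Ψ t) Z) :=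
    fun hZ t => (((mem_indexL1_iff P Ψ _).1 hZ).2 t).1
  have hid : ∀ {Z : Ω → ℝ}, Z ∈ indexL1 P Ψ → Integrable (distortionKernel P id Z) := fun hZ => by
    rw [← distortionKernel_zero hΨ hΨ']
    exact hint hZ 0
  obtain ⟨a, b, h1, h2⟩ := exists_crossing_of_not_comonotone hX.1 hY.1 hXY
  have hX' := indexL1_add_const hX (-a)
  have hY' := indexL1_add_const hY (-b)
  have hM := indexL1_max hX' hY'
  have hm := indexL1_min hX' hY'
  have hs := indexL1_add hM hm
  have hlt := integral_distortionKernel_lt_max_min hψ hX'.1 hY'.1 (hint hX' t) (hint hY' t)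
    (hint hM t) (hint hm t)
    (h1.trans_le (measure_mono fun ω hω => ⟨by linarith [hω.1], by linarith [hω.2]⟩))
    (h2.trans_le (measure_mono fun ω hω => ⟨by linarith [hω.1], by linarith [hω.2]⟩))
  have hle := integral_distortionKernel_superadditive P (Ψ t) hM.1 hm.1 (hid hM) (hid hm) (hid hs)
    (hint hM t) (hint hm t) (hint hs t)
  have e : (fun ω => max (X ω + -a) (Y ω + -b)) + (fun ω => min (X ω + -a) (Y ω + -b)) =
      fun ω => (X + Y) ω + (-a + -b) := by
    ext ω
    simp only [Pi.add_apply, max_add_min]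
    ring
  rw [e, integral_distortionKernel_add_const (hX.1.add hY.1) (hint (indexL1_add hX hY) t)] at hle
  rw [integral_distortionKernel_add_const hX.1 (hint hX t),
    integral_distortionKernel_add_const hY.1 (hint hY t)] at hlt
  linarith

end Strict

/-! ### Events of prescribed probability -/

namespace IsAtomless

variable {Ω : Type*} [MeasurableSpace Ω] {P : Measure Ω} [IsProbabilityMeasure P]

theorem exists_half (hP : IsAtomless P) {A : Set Ω} (hA : MeasurableSet A) (h0 : 0 < P.real A) :
    ∃ B ⊆ A, MeasurableSet B ∧ 0 < P.real B ∧ P.real B ≤ P.real A / 2 := by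
  obtain ⟨B, hBA, hB, hB0, hlt⟩ := hP A hA (ENNReal.toReal_pos_iff.1 h0).1
  have h1 : P.real (A \ B) = P.real A - P.real B := measureReal_sdiff hBA hB
  have h2 : 0 < P.real B := ENNReal.toReal_pos hB0.ne' (measure_ne_top _ _)
  have h3 : P.real B < P.real A :=
    (ENNReal.toReal_lt_toReal (measure_ne_top _ _) (measure_ne_top _ _)).2 hlt
  rcases le_total (P.real B) (P.real A / 2) with h | h
  · exact ⟨B, hBA, hB, h2, h⟩
  · exact ⟨A \ B, sdiff_subset, hA.diff hB, by linarith, by linarith⟩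

theorem exists_small (hP : IsAtomless P) {A : Set Ω} (hA : MeasurableSet A) (h0 : 0 < P.real A)
    {ε : ℝ} (hε : 0 < ε) : ∃ B ⊆ A, MeasurableSet B ∧ 0 < P.real B ∧ P.real B ≤ ε := by
  have h : ∀ n : ℕ, ∃ B ⊆ A, MeasurableSet B ∧ 0 < P.real B ∧ P.real B ≤ (1 / 2) ^ n := by
    intro n
    induction n with
    | zero => exact ⟨A, Subset.rfl, hA, h0, by simp⟩
    | succ n ih =>
      obtain ⟨B, hBA, hB, hB0, hle⟩ := ih
      obtain ⟨C, hCB, hC, hC0, hle'⟩ := hP.exists_half hB hB0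
      refine ⟨C, hCB.trans hBA, hC, hC0, ?_⟩
      rw [pow_succ]
      linarith
  obtain ⟨n, hn⟩ := exists_pow_lt_of_lt_one hε (show (1 / 2 : ℝ) < 1 by norm_num)
  obtain ⟨B, hBA, hB, hB0, hle⟩ := h n
  exact ⟨B, hBA, hB, hB0, hle.trans hn.le⟩

/-- Sierpiński's theorem: in an atomless probability space an event contains events of every
smaller probability. An increasing sequence of events of probability at most `r` is built
greedily, adding at each step a set of at least half the largest possible size. -/
theorem exists_measureReal_eq (hP : IsAtomless P) {A : Set Ω} (hA : MeasurableSet A) {r : ℝ}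
    (hr0 : 0 ≤ r) (hr : r ≤ P.real A) : ∃ B ⊆ A, MeasurableSet B ∧ P.real B = r := by
  have step : ∀ B : {B : Set Ω // B ⊆ A ∧ MeasurableSet B ∧ P.real B ≤ r},
      ∃ B' : {B : Set Ω // B ⊆ A ∧ MeasurableSet B ∧ P.real B ≤ r}, B.1 ⊆ B'.1 ∧
        ∀ D ⊆ A \ B.1, MeasurableSet D → P.real D ≤ r - P.real B.1 →
          P.real B.1 + P.real D / 2 ≤ P.real B'.1 := by
    rintro ⟨B, hBA, hB, hBr⟩
    set S := {u : ℝ | ∃ D ⊆ A \ B, MeasurableSet D ∧ P.real D ≤ r - P.real B ∧ P.real D = u}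
    have hbd : BddAbove S := ⟨r - P.real B, by rintro _ ⟨D, -, -, h, rfl⟩; exact h⟩
    have hne : (0 : ℝ) ∈ S := ⟨∅, empty_subset _, .empty, by simpa using hBr, by simp⟩
    have hS0 : 0 ≤ sSup S := le_csSup hbd hne
    obtain ⟨C, hCA, hC, hCr, hCS⟩ : ∃ C ⊆ A \ B, MeasurableSet C ∧ P.real C ≤ r - P.real B ∧
        sSup S / 2 ≤ P.real C := by
      rcases hS0.eq_or_lt with h | h
      · exact ⟨∅, empty_subset _, .empty, by simpa using hBr, by simp [← h]⟩
      · obtain ⟨_, ⟨D, h1, h2, h3, rfl⟩, hlt⟩ := exists_lt_of_lt_csSup ⟨0, hne⟩ (half_lt_self h)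
        exact ⟨D, h1, h2, h3, hlt.le⟩
    have hBC : P.real (B ∪ C) = P.real B + P.real C :=
      measureReal_union (disjoint_left.2 fun ω h1 h2 => (hCA h2).2 h1) hC
    refine ⟨⟨B ∪ C, union_subset hBA (hCA.trans sdiff_subset), hB.union hC, by linarith⟩,
      subset_union_left, fun D hD hDm hDr => ?_⟩
    have : P.real D ≤ sSup S := le_csSup hbd ⟨D, hD, hDm, hDr, rfl⟩
    simp only
    linarith
  choose grow hgrow_sub hbig using step
  let B : ℕ → {B : Set Ω // B ⊆ A ∧ MeasurableSet B ∧ P.real B ≤ r} := fun n =>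
    grow^[n] ⟨∅, empty_subset _, .empty, by simpa using hr0⟩
  have hsucc : ∀ n, B (n + 1) = grow (B n) := fun n => Function.iterate_succ_apply' _ _ _
  have hmono : Monotone fun n => (B n).1 := monotone_nat_of_le_succ fun n => by
    rw [hsucc]; exact hgrow_sub _
  have hUm : MeasurableSet (⋃ n, (B n).1) := .iUnion fun n => (B n).2.2.1
  have hUA : ⋃ n, (B n).1 ⊆ A := iUnion_subset fun n => (B n).2.1
  have hlim : Tendsto (fun n => P.real (B n).1) atTop (𝓝 (P.real (⋃ n, (B n).1))) :=
    (ENNReal.tendsto_toReal (measure_ne_top _ _)).comp (tendsto_measure_iUnion_atTop hmono)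
  have hUr : P.real (⋃ n, (B n).1) ≤ r := le_of_tendsto' hlim fun n => (B n).2.2.2
  refine ⟨⋃ n, (B n).1, hUA, hUm, le_antisymm hUr ?_⟩
  by_contra! hlt
  obtain ⟨D, hDA, hD, hD0, hDr⟩ := hP.exists_small (hA.diff hUm)
    (by rw [measureReal_sdiff hUA hUm]; linarith) (sub_pos.2 hlt)
  -- the same set `D` could be added at every step, so the probabilities would grow without bound
  have hlower : ∀ n : ℕ, n * (P.real D / 2) ≤ P.real (B n).1 := by
    intro n
    induction n with
    | zero => simp
    | succ n ih =>
      have hsub := subset_iUnion (fun n => (B n).1) n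
      have := hbig (B n) D (hDA.trans (sdiff_subset_sdiff_right hsub)) hD
        (hDr.trans (sub_le_sub_left (measureReal_mono hsub) _))
      rw [hsucc]
      push_cast
      linarith
  obtain ⟨n, hn⟩ := exists_nat_gt (1 / (P.real D / 2))
  rw [div_lt_iff₀ (by linarith)] at hn
  linarith [hlower n, measureReal_le_one (μ := P) (s := (B n).1)]

end IsAtomless

/-! ### A pair of random variables without strict diversification gain -/

section Counterexample

variable {Ω : Type*} [MeasurableSpace Ω] {P : Measure Ω}

/-- The random variable `v - p 1_D - q 1_A - r 1_B`. -/
noncomputable def stepVariable (v p q r : ℝ) (D A B : Set Ω) (ω : Ω) : ℝ :=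
  v - p * D.indicator (fun _ => 1) ω - q * A.indicator (fun _ => 1) ω -
    r * B.indicator (fun _ => 1) ω

theorem measurable_stepVariable (v p q r : ℝ) {D A B : Set Ω} (hD : MeasurableSet D)
    (hA : MeasurableSet A) (hB : MeasurableSet B) : Measurable (stepVariable v p q r D A B) :=
  (((measurable_const.sub ((measurable_const.indicator hD).const_mul p)).sub
    ((measurable_const.indicator hA).const_mul q)).sub
    ((measurable_const.indicator hB).const_mul r))

theorem not_comonotone_stepVariable {v : ℝ} {D A C C' : Set Ω} (hDA : D ⊆ A) (hAC : Disjoint A C)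
    (hAC' : Disjoint A C') (hCC' : Disjoint C C') (hC : 0 < P.real C) (hC' : 0 < P.real C') :
    ¬ Comonotone P (stepVariable v 1 0 1 D D (A ∪ C)) (stepVariable v 1 0 1 D D (A ∪ C')) := by
  rintro ⟨Z, f, g, -, hf, hg, hXf, hYg⟩
  have hex : ∀ S : Set Ω, 0 < P.real S → ∃ ω ∈ S,
      stepVariable v 1 0 1 D D (A ∪ C) ω = f (Z ω) ∧
      stepVariable v 1 0 1 D D (A ∪ C') ω = g (Z ω) := by
    intro S hS
    have hfreq : ∃ᵐ ω ∂P, ω ∈ S :=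
      frequently_ae_mem_iff.2 (ENNReal.toReal_pos_iff.1 hS).1.ne'
    obtain ⟨ω, h1, h2, h3⟩ := (hfreq.and_eventually (hXf.and hYg)).exists
    exact ⟨ω, h1, h2, h3⟩
  obtain ⟨ω, hω, h1, h2⟩ := hex C hC
  obtain ⟨ω', hω', h3, h4⟩ := hex C' hC'
  have m1 : ω ∉ A := fun h => disjoint_left.1 hAC h hω
  have m2 : ω ∉ C' := disjoint_left.1 hCC' hω
  have m3 : ω' ∉ A := fun h => disjoint_left.1 hAC' h hω'
  have m4 : ω' ∉ C := disjoint_right.1 hCC' hω'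
  have m5 : ω ∉ D := fun h => m1 (hDA h)
  have m6 : ω' ∉ D := fun h => m3 (hDA h)
  simp only [stepVariable, indicator, mem_union, m1, m2, m3, m4, m5, m6, hω, hω', or_true,
    or_false, if_true, if_false] at h1 h2 h3 h4
  have h5 : Z ω < Z ω' := by
    by_contra! hle
    linarith [hf hle]
  linarith [hg h5.le]

variable [IsProbabilityMeasure P]

theorem stepVariable_mem_indexL1 {Ψ : ℝ≥0 → ConcaveDistortion} (v p q r : ℝ) {D A B : Set Ω}
    (hD : MeasurableSet D) (hA : MeasurableSet A) (hB : MeasurableSet B) :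
    stepVariable v p q r D A B ∈ indexL1 P Ψ := by
  refine indexL1_of_bounded (measurable_stepVariable v p q r hD hA hB)
    (C := |v| + |p| + |q| + |r| + 1) fun ω => ?_
  have h : ∀ (c : ℝ) (S : Set Ω), |c * S.indicator (fun _ => 1) ω| ≤ |c| := by
    intro c S
    by_cases hS : ω ∈ S <;> simp [hS]
  unfold stepVariable
  linarith [abs_sub (v - p * D.indicator (fun _ => 1) ω - q * A.indicator (fun _ => 1) ω)
      (r * B.indicator (fun _ => 1) ω),
    abs_sub (v - p * D.indicator (fun _ => 1) ω) (q * A.indicator (fun _ => 1) ω),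
    abs_sub v (p * D.indicator (fun _ => 1) ω), h p D, h q A, h r B]

/-- On a chain of events distorted expectations are additive. -/
theorem integral_distortionKernel_stepVariable (ψ : ConcaveDistortion) {v p q r : ℝ} (hp : 0 ≤ p)
    (hq : 0 ≤ q) (hr : 0 ≤ r) {D A B : Set Ω} (hD : MeasurableSet D) (hA : MeasurableSet A)
    (hB : MeasurableSet B) (hDA : D ⊆ A) (hAB : A ⊆ B) :
    ∫ x, distortionKernel P ψ (stepVariable v p q r D A B) x =
      v - p * ψ (P.real D) - q * ψ (P.real A) - r * ψ (P.real B) := by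
  classical
  let J : ℝ → ℝ → ℝ := fun a x => (Ici a).indicator (fun _ => (1 : ℝ)) x
  have e : distortionKernel P ψ (stepVariable v p q r D A B) = fun x =>
      (J 0 x - J v x) - ψ (P.real D) * (J (v - r - q - p) x - J (v - r - q) x) -
        ψ (P.real A) * (J (v - r - q) x - J (v - r) x) - ψ (P.real B) * (J (v - r) x - J v x) := by
    ext x
    have hval : ∀ ω, stepVariable v p q r D A B ω =
        if ω ∈ D then v - r - q - p else if ω ∈ A then v - r - q else
          if ω ∈ B then v - r else v := by
      intro ω
      unfold stepVariable
      by_cases h1 : ω ∈ D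
      · have h2 := hDA h1
        have h3 := hAB h2
        simp [h1, h2, h3]; ring
      by_cases h2 : ω ∈ A
      · have h3 := hAB h2
        simp [h1, h2, h3]; ring
      by_cases h3 : ω ∈ B <;> simp [h1, h2, h3]
    have hlevel : ∀ S : Set Ω, (∀ ω, stepVariable v p q r D A B ω ≤ x ↔ ω ∈ S) →
        ψ (cdf (P.map (stepVariable v p q r D A B)) x) = ψ (P.real S) := by
      intro S hS
      rw [cdf_map_eq P (measurable_stepVariable v p q r hD hA hB)]
      congr 2
      ext ω
      exact hS ω
    simp only [distortionKernel, ψ.map_one]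
    have hJ1 : ∀ a, a ≤ x → J a x = 1 := fun a h => by simp [J, h]
    have hJ0 : ∀ a, x < a → J a x = 0 := fun a h => by simp [J, h]
    rcases le_or_gt v x with h1 | h1
    · rw [hlevel univ fun ω => by rw [hval]; simp only [mem_univ, iff_true]; split_ifs <;> linarith]
      rw [hJ1 v h1, hJ1 (v - r) (by linarith), hJ1 (v - r - q) (by linarith),
        hJ1 (v - r - q - p) (by linarith), probReal_univ, ψ.map_one]
      simp only [J]; ring
    rcases le_or_gt (v - r) x with h2 | h2
    · rw [hlevel B fun ω => by
        rw [hval]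
        have := @hDA ω
        have := @hAB ω
        split_ifs <;> grind]
      rw [hJ0 v h1, hJ1 (v - r) h2, hJ1 (v - r - q) (by linarith),
        hJ1 (v - r - q - p) (by linarith)]
      simp only [J]; ring
    rcases le_or_gt (v - r - q) x with h3 | h3
    · rw [hlevel A fun ω => by
        rw [hval]
        have := @hDA ω
        split_ifs <;> grind]
      rw [hJ0 v h1, hJ0 (v - r) h2, hJ1 (v - r - q) h3, hJ1 (v - r - q - p) (by linarith)]
      simp only [J]; ring
    rcases le_or_gt (v - r - q - p) x with h4 | h4
    · rw [hlevel D fun ω => by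
        rw [hval]
        split_ifs <;> grind]
      rw [hJ0 v h1, hJ0 (v - r) h2, hJ0 (v - r - q) h3, hJ1 (v - r - q - p) h4]
      simp only [J]; ring
    · rw [hlevel ∅ fun ω => by
        rw [hval]
        simp only [mem_empty_iff_false, iff_false, not_le]
        split_ifs <;> linarith]
      rw [hJ0 v h1, hJ0 (v - r) h2, hJ0 (v - r - q) h3, hJ0 (v - r - q - p) h4,
        measureReal_empty, ψ.map_zero]
      simp only [J]; ring
  have hJ : ∀ a b : ℝ, Integrable (fun x => J a x - J b x) ∧ ∫ x, (J a x - J b x) = b - a :=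
    integrable_indicator_Ici_sub
  have i1 := (hJ 0 v).1
  have i2 := (hJ (v - r - q - p) (v - r - q)).1.const_mul (ψ (P.real D))
  have i3 := (hJ (v - r - q) (v - r)).1.const_mul (ψ (P.real A))
  have i4 := (hJ (v - r) v).1.const_mul (ψ (P.real B))
  have i12 : Integrable fun x => (J 0 x - J v x) -
      ψ (P.real D) * (J (v - r - q - p) x - J (v - r - q) x) := i1.sub i2
  have i123 : Integrable fun x => (J 0 x - J v x) -
      ψ (P.real D) * (J (v - r - q - p) x - J (v - r - q) x) -
      ψ (P.real A) * (J (v - r - q) x - J (v - r) x) := i12.sub i3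
  simp only [e]
  rw [integral_sub i123 i4, integral_sub i12 i3, integral_sub i1 i2,
    integral_const_mul, integral_const_mul, integral_const_mul, (hJ _ _).2, (hJ _ _).2,
    (hJ _ _).2, (hJ _ _).2]
  ring

/-- If some `Ψ_t` fails to be strictly concave, then some `Ψ_t` is affine at `a`, `(a + b) / 2`,
`b` without having reached `1` on the whole of `(0, a]`. If the given `Ψ_t` equals `1` at some
interior point `a`, one takes for `t` the time at which the orbit of `a` reaches `1`. -/
theorem IsDistortionSemigroup.exists_affine {Ψ : ℝ≥0 → ConcaveDistortion}
    (hΨ : IsDistortionSemigroup Ψ) (hΨ' : IsNontrivialFamily Ψ)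
    (h : ¬ ∀ t : ℝ≥0, 0 < t → StrictConcaveOn ℝ (Icc 0 1) (Ψ t)) :
    ∃ t : ℝ≥0, 0 < t ∧ ∃ a b c : ℝ, 0 < c ∧ c ≤ a ∧ a < b ∧ b ≤ 1 ∧ Ψ t c < 1 ∧
      2 * Ψ t ((a + b) / 2) = Ψ t a + Ψ t b := by
  push Not at h
  obtain ⟨T, hT, hns⟩ := h
  obtain ⟨a₀, b₀, p, q, ha₀, hb₀, hab₀, haff⟩ := (Ψ T).concaveOn.exists_affine_of_not_strict hns
  set a := (a₀ + b₀) / 2 with ha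
  have haI : a ∈ Ioo (0 : ℝ) 1 := ⟨by linarith [ha₀.1], by linarith [hb₀.2]⟩
  have haI' := Ioo_subset_Icc_self haI
  rcases ((Ψ T).le_one haI').lt_or_eq with h1 | h1
  · refine ⟨T, hT, a, b₀, a, haI.1, le_rfl, by linarith, hb₀.2, h1, ?_⟩
    rw [haff a ⟨by linarith, by linarith⟩, haff b₀ ⟨by linarith, le_rfl⟩,
      haff ((a + b₀) / 2) ⟨by linarith, by linarith⟩]
    ring
  · set S := {t : ℝ≥0 | Ψ t a = 1}
    have hSc : IsClosed S := isClosed_eq (hΨ.continuous_time hΨ' haI') continuous_const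
    have hτ : sInf S ∈ S := hSc.csInf_mem ⟨T, h1⟩ (OrderBot.bddBelow S)
    set τ := sInf S
    have hτ1 : Ψ τ a = 1 := hτ
    have hτ0 : 0 < τ := by
      rw [pos_iff_ne_zero]
      intro h0
      rw [h0, hΨ.zero_apply hΨ' haI'] at hτ1
      linarith [haI.2]
    have hone : ∀ y, a ≤ y → y ≤ 1 → Ψ τ y = 1 := fun y h2 h3 =>
      le_antisymm ((Ψ τ).le_one ⟨haI.1.le.trans h2, h3⟩) (hτ1 ▸ (Ψ τ).mono haI.1.le h2 h3)
    have hcI : a / 2 ∈ Icc (0 : ℝ) 1 := ⟨by linarith [haI.1], by linarith [haI.1, haI.2]⟩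
    refine ⟨τ, hτ0, a, 1, a / 2, by linarith [haI.1], by linarith [haI.1], haI.2, le_rfl, ?_, ?_⟩
    · obtain ⟨s, hs⟩ := hΨ.exists_time_eq hΨ' (x := a / 2) (z := a) (by linarith [haI.1])
        (by linarith [haI.1]) haI.2
      rcases le_total τ s with h2 | h2
      · exact (hΨ.monotone_time h2 hcI).trans_lt (by rw [hs]; exact haI.2)
      · have hs0 : 0 < s := by
          rw [pos_iff_ne_zero]
          rintro rfl
          rw [hΨ.zero_apply hΨ' hcI] at hs
          linarith [haI.1]
        have h3 := hΨ (τ - s) s _ hcI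
        rw [tsub_add_cancel_of_le h2, hs] at h3
        rw [← h3]
        refine lt_of_le_of_ne ((Ψ _).le_one haI') fun h4 => ?_
        exact absurd (csInf_le (OrderBot.bddBelow S) h4) (not_le.2 (tsub_lt_self hτ0 hs0))
    · rw [hone a le_rfl haI.2.le, hone 1 haI.2.le le_rfl,
        hone ((a + 1) / 2) (by linarith [haI.2]) (by linarith [haI.2])]
      norm_num

/-- A failure of strict concavity produces two random variables that are not comonotone, have the
same index `t`, and whose sum has index at most `t`. -/
theorem exists_not_comonotone_acceptabilityIndex_add_le (hP : IsAtomless P)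
    {Ψ : ℝ≥0 → ConcaveDistortion} (hΨ : IsDistortionSemigroup Ψ) (hΨ' : IsNontrivialFamily Ψ)
    (h : ¬ ∀ t : ℝ≥0, 0 < t → StrictConcaveOn ℝ (Icc 0 1) (Ψ t)) :
    ∃ X ∈ indexL1 P Ψ, ∃ Y ∈ indexL1 P Ψ, ¬ Comonotone P X Y ∧ ∃ t : ℝ≥0, 0 < t ∧
      acceptabilityIndex P Ψ X = t ∧ acceptabilityIndex P Ψ Y = t ∧
      acceptabilityIndex P Ψ (X + Y) ≤ t := by
  obtain ⟨t, ht, a, b, c, hc0, hca, hab, hb1, hc1, haff⟩ := hΨ.exists_affine hΨ' h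
  set m := (a + b) / 2 with hm
  obtain ⟨A, -, hA, hPA⟩ := hP.exists_measureReal_eq .univ (hc0.le.trans hca)
    (by rw [probReal_univ]; linarith)
  obtain ⟨D, hDA, hD, hPD⟩ := hP.exists_measureReal_eq hA hc0.le (hca.trans hPA.ge)
  have hAc : P.real Aᶜ = 1 - a := by rw [probReal_compl_eq_one_sub hA, hPA]
  obtain ⟨C, hCA, hC, hPC⟩ := hP.exists_measureReal_eq hA.compl
    (show 0 ≤ (b - a) / 2 by linarith) (by linarith)
  obtain ⟨C', hCA', hC', hPC'⟩ := hP.exists_measureReal_eq (hA.compl.diff hC)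
    (show 0 ≤ (b - a) / 2 by linarith)
    (by rw [measureReal_sdiff hCA hC, hAc, hPC]; linarith)
  have dAC : Disjoint A C := disjoint_left.2 fun ω h1 h2 => hCA h2 h1
  have dAC' : Disjoint A C' := disjoint_left.2 fun ω h1 h2 => (hCA' h2).1 h1
  have dCC' : Disjoint C C' := disjoint_left.2 fun ω h1 h2 => (hCA' h2).2 h1
  have hPAC : P.real (A ∪ C) = m := by
    rw [measureReal_union dAC hC, hPA, hPC]; linarith
  have hPAC' : P.real (A ∪ C') = m := by
    rw [measureReal_union dAC' hC', hPA, hPC']; linarith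
  have hPB : P.real ((A ∪ C) ∪ C') = b := by
    rw [measureReal_union (disjoint_union_left.2 ⟨dAC', dCC'⟩) hC', hPAC, hPC']; linarith
  set v := Ψ t c + Ψ t m with hv
  have hint : ∀ {Z : Ω → ℝ}, Z ∈ indexL1 P Ψ → ∀ t, Integrable (distortionKernel P (Ψ t) Z) :=
    fun hZ t => (((mem_indexL1_iff P Ψ _).1 hZ).2 t).1
  have hcI : c ∈ Ioc (0 : ℝ) 1 := ⟨hc0, by linarith⟩
  have htime : ∀ s, t < s → ∀ x, 0 < x → x ≤ 1 → Ψ t x ≤ Ψ s x := fun s hs x h0 h1 =>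
    hΨ.monotone_time hs.le ⟨h0.le, h1⟩
  have hindex : ∀ E : Set Ω, MeasurableSet E → D ⊆ E → P.real E = m →
      acceptabilityIndex P Ψ (stepVariable v 1 0 1 D D E) = t := by
    intro E hE hDE hPE
    have hval : ∀ s, ∫ x, distortionKernel P (Ψ s) (stepVariable v 1 0 1 D D E) x =
        (Ψ t c - Ψ s c) + (Ψ t m - Ψ s m) := by
      intro s
      rw [integral_distortionKernel_stepVariable _ zero_le_one le_rfl zero_le_one hD hD hE
        Subset.rfl hDE, hPD, hPE]
      ring
    have hmem := hint (stepVariable_mem_indexL1 (P := P) (Ψ := Ψ) v 1 0 1 hD hD hE)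
    refine le_antisymm (acceptabilityIndex_le hmem fun s hs => ?_)
      (le_acceptabilityIndex (hmem t) (by rw [hval]; simp))
    rw [hval]
    linarith [hΨ.strict_time hΨ' hs hcI hc1, htime s hs m (by linarith) (by linarith)]
  refine ⟨_, stepVariable_mem_indexL1 v 1 0 1 hD hD (hA.union hC),
    _, stepVariable_mem_indexL1 v 1 0 1 hD hD (hA.union hC'),
    not_comonotone_stepVariable hDA dAC dAC' dCC' (by linarith) (by linarith), t, ht,
    hindex _ (hA.union hC) (hDA.trans subset_union_left) hPAC,
    hindex _ (hA.union hC') (hDA.trans subset_union_left) hPAC', ?_⟩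
  have hsum : stepVariable v 1 0 1 D D (A ∪ C) + stepVariable v 1 0 1 D D (A ∪ C') =
      stepVariable (2 * v) 2 1 1 D A ((A ∪ C) ∪ C') := by
    ext ω
    have h1 : ω ∈ C → ω ∉ A := fun h => disjoint_right.1 dAC h
    have h2 : ω ∈ C' → ω ∉ A := fun h => disjoint_right.1 dAC' h
    have h3 : ω ∈ C' → ω ∉ C := fun h => disjoint_right.1 dCC' h
    simp only [Pi.add_apply, stepVariable, indicator, mem_union]
    grind
  rw [hsum]
  refine acceptabilityIndex_le (hint (stepVariable_mem_indexL1 _ _ _ _ hD hA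
    ((hA.union hC).union hC'))) fun s hs => ?_
  rw [integral_distortionKernel_stepVariable _ zero_le_two zero_le_one zero_le_one hD hA
    ((hA.union hC).union hC') hDA (subset_union_left.trans subset_union_left), hPD, hPA, hPB]
  linarith [hΨ.strict_time hΨ' hs hcI hc1, htime s hs a (by linarith) (by linarith),
    htime s hs b (by linarith) hb1]

end Counterexample

theorem proposition2 {Ω : Type*} [MeasurableSpace Ω] (P : Measure Ω) [IsProbabilityMeasure P]
    (hP : IsAtomless P) (Ψ : ℝ≥0 → ConcaveDistortion) (hΨ : IsDistortionSemigroup Ψ)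
    (hΨ' : IsNontrivialFamily Ψ) :
    List.TFAE [
      ∀ X ∈ indexL1 P Ψ, ∀ Y ∈ indexL1 P Ψ, ¬ Comonotone P X Y →
        0 < acceptabilityIndex P Ψ X → acceptabilityIndex P Ψ X = acceptabilityIndex P Ψ Y →
        acceptabilityIndex P Ψ X < ⊤ →
        acceptabilityIndex P Ψ X < acceptabilityIndex P Ψ (X + Y),
      ∀ t : ℝ≥0, 0 < t → StrictConcaveOn ℝ (Icc 0 1) (Ψ t),
      StrictConcaveOn ℝ (Ioo 0 1) (generator Ψ) ∧
        ∀ ε ∈ Ioo (0 : ℝ) 1,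
          ∫⁻ s in Ioo (1 - ε) 1, ENNReal.ofReal (1 / generator Ψ s) = ⊤] := by
  tfae_have 2 ↔ 3 := hΨ.strictConcaveOn_iff hΨ'
  tfae_have 2 → 1 := by
    intro hs X hX Y hY hXY h0 heq htop
    obtain ⟨t, ht⟩ : ∃ t : ℝ≥0, (t : ℝ≥0∞) = acceptabilityIndex P Ψ X :=
      ⟨_, ENNReal.coe_toNNReal htop.ne⟩
    have ht0 : 0 < t := by rw [← ht] at h0; exact_mod_cast h0
    have hint : ∀ {Z : Ω → ℝ}, Z ∈ indexL1 P Ψ →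
        ∀ t, Integrable (distortionKernel P (Ψ t) Z) :=
      fun hZ t => (((mem_indexL1_iff P Ψ _).1 hZ).2 t).1
    have h1 := integral_nonneg_of_acceptabilityIndex_eq hΨ hΨ' (hint hX) ht0 ht.symm
    have h2 := integral_nonneg_of_acceptabilityIndex_eq hΨ hΨ' (hint hY) ht0 (ht.trans heq).symm
    have h3 := integral_distortionKernel_strict_superadditive hΨ hΨ' (hs t ht0) hX hY hXY
    rw [← ht]
    exact lt_acceptabilityIndex hΨ hΨ' (hint (indexL1_add hX hY)) (by linarith)
  tfae_have 1 → 2 := by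
    intro ha
    by_contra hns
    obtain ⟨X, hX, Y, hY, hXY, t, ht, h1, h2, h3⟩ :=
      exists_not_comonotone_acceptabilityIndex_add_le hP hΨ hΨ' hns
    have := ha X hX Y hY hXY (by rw [h1]; exact_mod_cast ht) (h1.trans h2.symm)
      (by rw [h1]; exact ENNReal.coe_lt_top)
    rw [h1] at this
    exact absurd h3 (not_le.2 this)
  tfae_finish
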